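/- Let $q:[0,1]\to[0,1]$ be the Minkowski question mark function, $q([0;a_1,a_2,\dots])=2\sum_{i\ge 1}(-1)^{i+1}2^{-(a_1+\dots+a_i)}$ (a finite sum when the regular continued fraction is finite; $q(1)=1$), and let $dq$ be its Stieltjes measure. For $x\in\mathbb{R}$ put $$f(x)=\int_0^1 e^{ixt}\,dq(t),\qquad f_s(x)=\int_0^1 \sin(xt)\,dq(t),\qquad f_c(x)=\int_0^1\cos(xt)\,dq(t),$$ and for $n\in\mathbb{N}=\{1,2,\dots\}$ put $$d_n=f(2\pi n),\qquad c_n=\int_0^1 t\sin(2\pi n t)\,dq(t).$$ Let $J_0(z)=\sum_{k\ge 0}\frac{(-1)^k}{(k!)^2}\left(\frac z2\right)^{2k}$ be the Bessel function of the first kind of order $0$. Then, for every $n\in\mathbb{N}$, the following improper integrals converge (as limits of $\int_0^Y$ for $Y\to\infty$), and $$d_n=\frac25\int_0^\infty J_0\left(2\sqrt{2\pi n y}\right)f_s(y)\,dy,\qquad c_n=\int_0^\infty J_0\left(2\sqrt{2\pi n y}\right)f_c(y)\,dy.$$ -/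

import Mathlib

namespace QuestionMark

open Filter Topology MeasureTheory

/-- The `i`-th term (`i = 0, 1, 2, …`) of the series defining the question mark function at `x`:
it is `(-1)^i * 2^(-(a₁ + ⋯ + a_{i+1}))`, where `a₁, a₂, …` are the partial denominators of the
regular continued fraction `x = [a₀; a₁, a₂, …]`, and it is `0` if the continued fraction stops
before `a_{i+1}`. -/
noncomputable def qTerm (x : ℝ) (i : ℕ) : ℝ :=
  if (GenContFract.of x).partDens.get? i = none then 0
  else (-1) ^ i *
    (2 : ℝ) ^ (-∑ j ∈ Finset.range (i + 1), ((GenContFract.of x).partDens.get? j).getD 0)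

/-- The Minkowski question mark function,
`q [a₀; a₁, a₂, …] = a₀ + 2 * ∑_{i ≥ 1} (-1)^(i+1) * 2^(-(a₁ + ⋯ + a_i))`. On `[0,1)` one has
`a₀ = 0`, and `q 1 = 1`. -/
noncomputable def q (x : ℝ) : ℝ := ⌊x⌋ + 2 * ∑' i, qTerm x i

lemma sum_dens_ge (x : ℝ) (i : ℕ) (h : (GenContFract.of x).partDens.get? i ≠ none) :
    (i + 1 : ℝ) ≤
      ∑ j ∈ Finset.range (i + 1), ((GenContFract.of x).partDens.get? j).getD 0 := by
  have h1 : ∀ j ∈ Finset.range (i + 1),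
      (1 : ℝ) ≤ ((GenContFract.of x).partDens.get? j).getD 0 := by
    intro j hj
    have hj' : (GenContFract.of x).partDens.get? j ≠ none := fun hn =>
      h (Stream'.Seq.le_stable _ (Nat.lt_succ_iff.mp (Finset.mem_range.mp hj)) hn)
    obtain ⟨b, hb⟩ := Option.ne_none_iff_exists'.mp hj'
    rw [hb]
    exact GenContFract.of_one_le_get?_partDen hb
  have := Finset.sum_le_sum h1
  simpa using this

lemma abs_qTerm_le (x : ℝ) (i : ℕ) : |qTerm x i| ≤ 1 / 2 * (1 / 2) ^ i := by
  unfold qTerm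
  split_ifs with h
  · simp
  · rw [abs_mul, abs_pow, abs_neg, abs_one, one_pow, one_mul, abs_of_pos (by positivity)]
    have := sum_dens_ge x i h
    calc _ ≤ (2 : ℝ) ^ (-((i + 1 : ℕ) : ℝ)) := by
          apply Real.rpow_le_rpow_of_exponent_le (by norm_num)
          push_cast
          linarith
      _ = _ := by
          rw [Real.rpow_neg (by norm_num), Real.rpow_natCast, pow_succ]
          simp [mul_comm]

lemma summable_qTerm (x : ℝ) : Summable (qTerm x) :=
  Summable.of_norm_bounded ((summable_geometric_two).mul_left (1 / 2))
    (fun i => abs_qTerm_le x i)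

lemma abs_tsum_qTerm_le (x : ℝ) : |∑' i, qTerm x i| ≤ 1 := by
  have h := tsum_of_norm_bounded (f := qTerm x) (a := 1)
    (by simpa using hasSum_geometric_two.mul_left (1 / 2 : ℝ)) (fun i => abs_qTerm_le x i)
  exact h

lemma partDens_get?_succ (x : ℝ) (i : ℕ) :
    (GenContFract.of x).partDens.get? (i + 1) =
      (GenContFract.of (Int.fract x)⁻¹).partDens.get? i := by
  simp only [GenContFract.partDens, Stream'.Seq.map_get?, GenContFract.of_s_succ]

lemma partDens_get?_zero {x : ℝ} (h : Int.fract x ≠ 0) :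
    (GenContFract.of x).partDens.get? 0 = some (⌊(Int.fract x)⁻¹⌋ : ℝ) := by
  have h0 := GenContFract.of_s_head h
  have h1 : (GenContFract.of x).s.get? 0 = some ⟨1, (⌊(Int.fract x)⁻¹⌋ : ℝ)⟩ := h0
  simp [GenContFract.partDens, Stream'.Seq.map_get?, h1]

lemma tsum_of_fract_eq_zero {x : ℝ} (h : Int.fract x = 0) : ∑' i, qTerm x i = 0 := by
  obtain ⟨a, rfl⟩ : ∃ a : ℤ, x = a := ⟨⌊x⌋, eq_of_sub_eq_zero h⟩
  have : ∀ i, qTerm (a : ℝ) i = 0 := by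
    intro i
    simp [qTerm, GenContFract.partDens, GenContFract.of_s_of_int]
  simp [this]

lemma tsum_of_fract_ne_zero {x : ℝ} (h : Int.fract x ≠ 0) :
    ∑' i, qTerm x i =
      (2 : ℝ) ^ (-(⌊(Int.fract x)⁻¹⌋ : ℝ)) * (1 - ∑' i, qTerm (Int.fract x)⁻¹ i) := by
  rw [(summable_qTerm x).tsum_eq_zero_add]
  have h0 : qTerm x 0 = (2 : ℝ) ^ (-(⌊(Int.fract x)⁻¹⌋ : ℝ)) := by
    simp [qTerm, partDens_get?_zero h]
  have h1 : ∀ i, qTerm x (i + 1) =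
      -(2 : ℝ) ^ (-(⌊(Int.fract x)⁻¹⌋ : ℝ)) * qTerm (Int.fract x)⁻¹ i := by
    intro i
    unfold qTerm
    rw [partDens_get?_succ]
    split_ifs with hn
    · simp
    · rw [Finset.sum_range_succ' _ (i + 1), partDens_get?_zero h, neg_add, Real.rpow_add two_pos]
      simp only [partDens_get?_succ, Option.getD_some, pow_succ]
      ring
  rw [h0, tsum_congr h1, tsum_mul_left]
  ring

lemma one_le_floor_inv_fract {x : ℝ} (h : Int.fract x ≠ 0) : 1 ≤ ⌊(Int.fract x)⁻¹⌋ := by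
  have h0 : 0 < Int.fract x := lt_of_le_of_ne (Int.fract_nonneg x) (Ne.symm h)
  rw [Int.le_floor]
  simpa using (one_lt_inv₀ h0).mpr (Int.fract_lt_one x) |>.le

lemma two_rpow_neg_le {a b : ℤ} (h : a ≤ b) :
    (2 : ℝ) ^ (-(b : ℝ)) ≤ (2 : ℝ) ^ (-(a : ℝ)) :=
  Real.rpow_le_rpow_of_exponent_le (by norm_num) (by simpa using (Int.cast_le (R := ℝ)).mpr h)

lemma two_rpow_neg_one : (2 : ℝ) ^ (-((1 : ℤ) : ℝ)) = 1 / 2 := by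
  rw [Int.cast_one, Real.rpow_neg_one]
  norm_num

lemma tsum_qTerm_nonneg (x : ℝ) : 0 ≤ ∑' i, qTerm x i := by
  by_cases h : Int.fract x = 0
  · rw [tsum_of_fract_eq_zero h]
  · rw [tsum_of_fract_ne_zero h]
    have := (abs_le.mp (abs_tsum_qTerm_le (Int.fract x)⁻¹)).2
    exact mul_nonneg (by positivity) (by linarith)

lemma tsum_qTerm_le_half (x : ℝ) : ∑' i, qTerm x i ≤ 1 / 2 := by
  by_cases h : Int.fract x = 0
  · rw [tsum_of_fract_eq_zero h]
    norm_num
  · rw [tsum_of_fract_ne_zero h]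
    have h1 := tsum_qTerm_nonneg (Int.fract x)⁻¹
    have h2 := two_rpow_neg_le (one_le_floor_inv_fract h)
    rw [two_rpow_neg_one] at h2
    have h3 : (0 : ℝ) < (2 : ℝ) ^ (-(⌊(Int.fract x)⁻¹⌋ : ℝ)) := by positivity
    nlinarith

lemma tsum_qTerm_sub_le (k : ℕ) : ∀ x y : ℝ, x ≤ y → ⌊x⌋ = ⌊y⌋ →
    ∑' i, qTerm x i - ∑' i, qTerm y i ≤ (1 / 2) ^ k := by
  induction k with
  | zero =>
    intro x y _ _
    have h1 := tsum_qTerm_le_half x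
    have h2 := tsum_qTerm_nonneg y
    norm_num
    linarith
  | succ k ih =>
    intro x y hxy hfl
    have hfr : Int.fract x ≤ Int.fract y := by
      simp only [Int.fract, hfl]
      linarith
    by_cases hx : Int.fract x = 0
    · rw [tsum_of_fract_eq_zero hx]
      have h2 := tsum_qTerm_nonneg y
      have : (0 : ℝ) ≤ (1 / 2) ^ (k + 1) := by positivity
      linarith
    have hx0 : 0 < Int.fract x := lt_of_le_of_ne (Int.fract_nonneg x) (Ne.symm hx)
    have hy : Int.fract y ≠ 0 := (hx0.trans_le hfr).ne'
    have hinv : (Int.fract y)⁻¹ ≤ (Int.fract x)⁻¹ := inv_anti₀ hx0 hfr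
    rw [tsum_of_fract_ne_zero hx, tsum_of_fract_ne_zero hy]
    rcases (Int.floor_mono hinv).lt_or_eq with hlt | heq
    · have h1 := two_rpow_neg_le (Int.add_one_le_of_lt hlt)
      have h2 : (2 : ℝ) ^ (-((⌊(Int.fract y)⁻¹⌋ + 1 : ℤ) : ℝ)) =
          (2 : ℝ) ^ (-(⌊(Int.fract y)⁻¹⌋ : ℝ)) * (1 / 2) := by
        rw [Int.cast_add, neg_add, Real.rpow_add two_pos, two_rpow_neg_one]
      rw [h2] at h1
      have h3 := tsum_qTerm_nonneg (Int.fract x)⁻¹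
      have h4 := tsum_qTerm_le_half (Int.fract y)⁻¹
      have h5 : (0 : ℝ) < (2 : ℝ) ^ (-(⌊(Int.fract x)⁻¹⌋ : ℝ)) := by positivity
      have h6 : (0 : ℝ) < (2 : ℝ) ^ (-(⌊(Int.fract y)⁻¹⌋ : ℝ)) := by positivity
      have : (0 : ℝ) ≤ (1 / 2) ^ (k + 1) := by positivity
      nlinarith
    · rw [← heq]
      have h1 := ih _ _ hinv heq
      have h2 := two_rpow_neg_le (one_le_floor_inv_fract hy)
      rw [two_rpow_neg_one] at h2
      have h6 : (0 : ℝ) < (2 : ℝ) ^ (-(⌊(Int.fract y)⁻¹⌋ : ℝ)) := by positivity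
      have h7 : (0 : ℝ) ≤ (1 / 2) ^ k := by positivity
      rw [← mul_sub, pow_succ]
      calc _ ≤ (2 : ℝ) ^ (-(⌊(Int.fract y)⁻¹⌋ : ℝ)) * (1 / 2) ^ k :=
            mul_le_mul_of_nonneg_left (by linarith) h6.le
        _ ≤ 1 / 2 * (1 / 2) ^ k := mul_le_mul_of_nonneg_right h2 h7
        _ = _ := mul_comm _ _

lemma monotone_q : Monotone q := by
  intro x y hxy
  unfold q
  rcases (Int.floor_mono hxy).lt_or_eq with hlt | heq
  · have h1 := tsum_qTerm_le_half x
    have h2 := tsum_qTerm_nonneg y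
    have h3 : (⌊x⌋ : ℝ) + 1 ≤ ⌊y⌋ := by exact_mod_cast hlt
    linarith
  · have h : ∑' i, qTerm x i - ∑' i, qTerm y i ≤ 0 :=
      ge_of_tendsto' (tendsto_pow_atTop_nhds_zero_of_lt_one (by norm_num) (by norm_num))
        (fun k => tsum_qTerm_sub_le k x y hxy heq)
    rw [heq]
    linarith

/-- The Lebesgue–Stieltjes measure `dq` of the question mark function. -/
noncomputable def dq : Measure ℝ := monotone_q.stieltjesFunction.measure

/-- The Fourier–Stieltjes transform of `q` over `[0,1]`. -/
noncomputable def f (x : ℝ) : ℂ :=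
  ∫ t in Set.Icc (0 : ℝ) 1, Complex.exp (Complex.I * x * t) ∂dq

/-- The Fourier–Stieltjes sine transform of `q`. -/
noncomputable def fs (x : ℝ) : ℝ := ∫ t in Set.Icc (0 : ℝ) 1, Real.sin (x * t) ∂dq

/-- The Fourier–Stieltjes cosine transform of `q`. -/
noncomputable def fc (x : ℝ) : ℝ := ∫ t in Set.Icc (0 : ℝ) 1, Real.cos (x * t) ∂dq

/-- The Fourier–Stieltjes coefficients `d_n = f(2πn)` of `q`. -/
noncomputable def d (n : ℕ) : ℂ := f (2 * Real.pi * n)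

/-- The coefficients `c_n = ∫₀¹ t sin(2πnt) dq(t)`. -/
noncomputable def c (n : ℕ) : ℝ :=
  ∫ t in Set.Icc (0 : ℝ) 1, t * Real.sin (2 * Real.pi * n * t) ∂dq

/-- The Bessel function of the first kind of order zero. -/
noncomputable def J0 (z : ℝ) : ℝ :=
  ∑' k : ℕ, (-1) ^ k / (k.factorial : ℝ) ^ 2 * (z / 2) ^ (2 * k)

/-- `g` is integrable on `[0, Y]` for every `Y ≥ 0`, and the (possibly only conditionally
convergent) integral of `g` over `(0, ∞)` converges, with value `I`. -/
def HasImproperIntegral (g : ℝ → ℝ) (I : ℝ) : Prop :=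
  (∀ Y : ℝ, 0 ≤ Y → IntervalIntegrable g volume 0 Y) ∧
    Tendsto (fun Y : ℝ => ∫ y in (0 : ℝ)..Y, g y) atTop (𝓝 I)

end QuestionMark

/-!
Why the identities hold. Write `a = 2πn`. For `t > 0` the Laplace transform
`∫₀^∞ J₀(2√(ay)) e^{-sy} dy = e^{-a/s} / s`, continued to `s = -it`, says that
`∫₀^∞ J₀(2√(ay)) e^{ity} dy = (i / t) e^{-ia/t}` as a conditionally convergent integral.
Integrating over `t` against `dq` turns the left side into `∫₀^∞ J₀(2√(ay)) f(y) dy`, and the right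
side into `i ∫ t⁻¹ e^{-ia/t} dq(t)`. The measure `dq` on `[0, 1]` is the average of its images under
`x ↦ x / (1 + x)` and `x ↦ 1 / (1 + x)`. These maps turn `1 / t` into `1 / x + 1` and `1 + x`, and
`e^{-ia} = 1`, so self-similarity gives `∫ t⁻¹ e^{-ia/t} dq(t) = ∫ (2 + t) e^{-iat} dq(t)`
(`integral_exp_inv_mul_inv`). By the symmetry `t ↦ 1 - t` of `dq` the sine transform vanishes at `a`
and `∫ t cos(at) dq(t) = d_n / 2`, so `i` times the last integral is `c_n + (5/2) i d_n`
(`integral_two_add_mul_exp`); real and imaginary parts are the two claims.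

Exchanging the improper integral with `dq` (`tendsto_integral_clifford_mul_f`) is the analytic
point. With `y = clifford 0`, the function `x ↦ J₀(2√x)`, an energy argument for
`x y'' + y' + y = 0` gives `y = O(x^(-1/4))`, `y' = O(x^(-1/4))` and `y'' = O(x^(-5/4))`
(`exists_clifford_bound`). Two integrations by parts then show that the partial integrals converge,
that their limit depends continuously on `s` up to the imaginary axis, and that they are dominated
by a combination of `1 / t` and `1 / t²`. These are `dq`-integrable, again by self-similarity
(`integral_min_inv_sq_le`).
-/

namespace QuestionMark

open Filter Topology MeasureTheory

/-! ### Functional equations and continuity of the question mark function -/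

lemma q_add_one (x : ℝ) : q (x + 1) = q x + 1 := by
  have h : ∑' i, qTerm (x + 1) i = ∑' i, qTerm x i := by
    by_cases h : Int.fract x = 0
    · rw [tsum_of_fract_eq_zero h, tsum_of_fract_eq_zero (by rwa [Int.fract_add_one])]
    · rw [tsum_of_fract_ne_zero h, tsum_of_fract_ne_zero (by rwa [Int.fract_add_one]),
        Int.fract_add_one]
  unfold q
  rw [h, Int.floor_add_one]
  push_cast
  ring

lemma q_zero : q 0 = 0 := by
  unfold q
  rw [tsum_of_fract_eq_zero (by simp)]
  simp

lemma q_one : q 1 = 1 := by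
  simpa [q_zero] using q_add_one 0

lemma q_add_int (x : ℝ) (m : ℤ) : q (x + m) = q x + m := by
  have h (x : ℝ) (m : ℕ) : q (x + m) = q x + m := by
    induction m with
    | zero => simp
    | succ m ih =>
      push_cast
      rw [← add_assoc, q_add_one, ih, add_assoc]
  obtain ⟨m, rfl | rfl⟩ := m.eq_nat_or_neg
  · exact_mod_cast h x m
  · have := h (x + ((-m : ℤ) : ℝ)) m
    push_cast at this ⊢
    rw [neg_add_cancel_right] at this
    linarith

/-- The shift of partial denominators `[0; ⌊x⌋, a₂, …] = 1 / [⌊x⌋; a₂, …]`. -/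
lemma q_inv {x : ℝ} (hx : 1 ≤ x) : q x⁻¹ = (2 : ℝ) ^ (-(⌊x⌋ : ℝ)) * (2 - (q x - ⌊x⌋)) := by
  rcases hx.eq_or_lt with rfl | hx
  · rw [inv_one, q_one, Int.floor_one, two_rpow_neg_one]
    norm_num
  · have hx0 : 0 < x := by linarith
    have hfl : ⌊x⁻¹⌋ = 0 :=
      Int.floor_eq_zero_iff.mpr ⟨(inv_pos.mpr hx0).le, inv_lt_one_of_one_lt₀ hx⟩
    have hfr : Int.fract x⁻¹ = x⁻¹ := by rw [Int.fract, hfl]; simp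
    have h := tsum_of_fract_ne_zero (x := x⁻¹) (by rw [hfr]; exact (inv_pos.mpr hx0).ne')
    rw [hfr, inv_inv] at h
    unfold q
    rw [h, hfl]
    push_cast
    ring

lemma q_div_one_add {x : ℝ} (h0 : 0 ≤ x) (h1 : x ≤ 1) : q (x / (1 + x)) = q x / 2 := by
  rcases h0.eq_or_lt with rfl | h0
  · simp [q_zero]
  · have hx : 1 ≤ x⁻¹ := (one_le_inv₀ h0).mpr h1
    have h2 := q_inv hx
    have h3 := q_inv (x := x⁻¹ + 1) (by linarith)
    have e : (x⁻¹ + 1)⁻¹ = x / (1 + x) := by field_simp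
    rw [q_add_one, e, Int.floor_add_one, Int.cast_add, neg_add, Real.rpow_add two_pos,
      two_rpow_neg_one] at h3
    rw [inv_inv] at h2
    rw [h3, h2]
    push_cast
    ring

lemma q_one_div_one_add {x : ℝ} (h0 : 0 ≤ x) (h1 : x ≤ 1) :
    q (1 / (1 + x)) = 1 - q x / 2 := by
  rcases h1.eq_or_lt with rfl | h1
  · have := q_div_one_add h0 h1
    rw [q_one] at this ⊢
    linarith
  · have h3 := q_inv (x := x + 1) (by linarith)
    rw [q_add_one, Int.floor_add_one, Int.floor_eq_zero_iff.mpr ⟨h0, h1⟩, zero_add,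
      two_rpow_neg_one] at h3
    rw [one_div, add_comm, h3]
    push_cast
    ring

/-- Points `x ≤ 1 / 2` and `1 - x` are the images of `y = x / (1 - x)` under `y ↦ y / (1 + y)` and
`y ↦ 1 / (1 + y)`. -/
lemma q_one_sub {x : ℝ} (h0 : 0 ≤ x) (h1 : x ≤ 1) : q (1 - x) = 1 - q x := by
  have key {x : ℝ} (h0 : 0 ≤ x) (h1 : x ≤ 1 / 2) : q (1 - x) = 1 - q x := by
    have hx : 0 < 1 - x := by linarith
    have hy0 : 0 ≤ x / (1 - x) := by positivity
    have hy1 : x / (1 - x) ≤ 1 := by rw [div_le_one hx]; linarith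
    have e1 : x / (1 - x) / (1 + x / (1 - x)) = x := by field_simp; ring
    have e2 : 1 / (1 + x / (1 - x)) = 1 - x := by field_simp; ring
    have h2 := q_div_one_add hy0 hy1
    have h3 := q_one_div_one_add hy0 hy1
    rw [e1] at h2
    rw [e2] at h3
    rw [h2, h3]
  rcases le_total x (1 / 2) with h | h
  · exact key h0 h
  · have := key (x := 1 - x) (by linarith) (by linarith)
    rw [sub_sub_cancel] at this
    linarith

/-- The question mark function takes every dyadic value in `[0, 1]`: halve with
`x ↦ x / (1 + x)`, and reflect with `x ↦ 1 - x`. -/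
lemma exists_q_eq_dyadic (n m : ℕ) (hm : m ≤ 2 ^ n) :
    ∃ x ∈ Set.Icc (0 : ℝ) 1, q x = m / 2 ^ n := by
  induction n generalizing m with
  | zero =>
    have : m ≤ 1 := by simpa using hm
    interval_cases m
    · exact ⟨0, by simp, by simp [q_zero]⟩
    · exact ⟨1, by simp, by simp [q_one]⟩
  | succ n ih =>
    have key (m : ℕ) (hm : m ≤ 2 ^ n) : ∃ x ∈ Set.Icc (0 : ℝ) 1, q x = m / 2 ^ (n + 1) := by
      obtain ⟨x, ⟨h0, h1⟩, hx⟩ := ih m hm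
      refine ⟨x / (1 + x), ⟨by positivity, ?_⟩, ?_⟩
      · rw [div_le_one (by linarith)]; linarith
      · rw [q_div_one_add h0 h1, hx, pow_succ]
        field_simp
    rcases le_total m (2 ^ n) with h | h
    · exact key m h
    · have h2 : 2 ^ (n + 1) - m ≤ 2 ^ n := by rw [pow_succ]; omega
      obtain ⟨x, ⟨h0, h1⟩, hx⟩ := key _ h2
      refine ⟨1 - x, ⟨by linarith, by linarith⟩, ?_⟩
      rw [q_one_sub h0 h1, hx, Nat.cast_sub hm]
      push_cast
      field_simp
      ring

lemma continuous_q : Continuous q := by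
  refine monotone_q.continuous_of_denseRange ?_
  rw [Metric.denseRange_iff]
  intro y ε hε
  obtain ⟨n, hn⟩ := exists_pow_lt_of_lt_one hε (by norm_num : (1 / 2 : ℝ) < 1)
  have hp : (0 : ℝ) < 2 ^ n := by positivity
  have hz : 0 ≤ Int.fract y * 2 ^ n := mul_nonneg (Int.fract_nonneg y) hp.le
  have hm : ⌊Int.fract y * 2 ^ n⌋₊ ≤ 2 ^ n := by
    apply Nat.floor_le_of_le
    push_cast
    nlinarith [Int.fract_lt_one y]
  obtain ⟨x, -, hx⟩ := exists_q_eq_dyadic n _ hm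
  refine ⟨x + ⌊y⌋, ?_⟩
  have h1 := Nat.floor_le hz
  have h2 := Nat.lt_floor_add_one (Int.fract y * 2 ^ n)
  have h3 : (⌊Int.fract y * 2 ^ n⌋₊ : ℝ) / 2 ^ n ≤ Int.fract y := by rwa [div_le_iff₀ hp]
  have h4 : Int.fract y < (⌊Int.fract y * 2 ^ n⌋₊ : ℝ) / 2 ^ n + (1 / 2) ^ n := by
    rw [one_div, inv_pow, ← one_div, ← add_div, lt_div_iff₀ hp]
    exact h2
  rw [q_add_int, hx, Real.dist_eq, abs_lt]
  have h5 := Int.floor_add_fract y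
  constructor <;> linarith

/-! ### The self-similar measure on the unit interval -/

/-- The restriction of `dq` to `[0, 1]`, the measure all transforms in this file are taken
against. -/
noncomputable def unitMeasure : Measure ℝ := dq.restrict (Set.Icc 0 1)

/-- Continuity of `q` makes the one-sided limits in the Stieltjes measure equal to `q`. -/
lemma dq_Icc (x y : ℝ) : dq (Set.Icc x y) = ENNReal.ofReal (q y - q x) := by
  have h : ∀ x, monotone_q.stieltjesFunction x = q x := fun x => by
    rw [monotone_q.stieltjesFunction_eq]
    exact continuous_q.continuousAt.continuousWithinAt.rightLim_eq
  have h' : (monotone_q.stieltjesFunction : ℝ → ℝ) = q := funext h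
  rw [dq, StieltjesFunction.measure_Icc, h', continuous_q.continuousWithinAt.leftLim_eq]

lemma unitMeasure_Iic {b : ℝ} (h1 : b ≤ 1) :
    unitMeasure (Set.Iic b) = ENNReal.ofReal (q b) := by
  have h : Set.Iic b ∩ Set.Icc 0 1 = Set.Icc 0 b := by
    ext x
    simp only [Set.mem_inter_iff, Set.mem_Iic, Set.mem_Icc]
    exact ⟨fun h => ⟨h.2.1, h.1⟩, fun h => ⟨h.2, h.1, h.2.trans h1⟩⟩
  rw [unitMeasure, Measure.restrict_apply measurableSet_Iic, h, dq_Icc, q_zero, sub_zero]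

lemma unitMeasure_Ici {b : ℝ} (h0 : 0 ≤ b) :
    unitMeasure (Set.Ici b) = ENNReal.ofReal (1 - q b) := by
  have h : Set.Ici b ∩ Set.Icc 0 1 = Set.Icc b 1 := by
    ext x
    simp only [Set.mem_inter_iff, Set.mem_Ici, Set.mem_Icc]
    exact ⟨fun h => ⟨h.1, h.2.2⟩, fun h => ⟨h.1, h0.trans h.1, h.2⟩⟩
  rw [unitMeasure, Measure.restrict_apply measurableSet_Ici, h, dq_Icc, q_one]

lemma ae_mem_Icc : ∀ᵐ x ∂unitMeasure, x ∈ Set.Icc (0 : ℝ) 1 :=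
  ae_restrict_mem measurableSet_Icc

lemma unitMeasure_univ : unitMeasure Set.univ = 1 := by
  rw [unitMeasure, Measure.restrict_apply_univ, dq_Icc, q_zero, q_one]
  simp

instance : IsProbabilityMeasure unitMeasure := ⟨unitMeasure_univ⟩

lemma ae_mem_Ioc : ∀ᵐ x ∂unitMeasure, x ∈ Set.Ioc (0 : ℝ) 1 := by
  have h : unitMeasure (Set.Iic 0) = 0 := by
    rw [unitMeasure_Iic zero_le_one, q_zero, ENNReal.ofReal_zero]
  filter_upwards [ae_mem_Icc, measure_eq_zero_iff_ae_notMem.mp h] with x hx hx'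
  exact ⟨not_le.mp hx', hx.2⟩

lemma q_nonpos {x : ℝ} (h : x ≤ 0) : q x ≤ 0 := q_zero ▸ monotone_q h

lemma unitMeasure_congr {s t : Set ℝ} (h : ∀ x ∈ Set.Icc (0 : ℝ) 1, x ∈ s ↔ x ∈ t) :
    unitMeasure s = unitMeasure t := by
  refine measure_congr ?_
  filter_upwards [ae_mem_Icc] with x hx
  exact propext (h x hx)

lemma unitMeasure_eq_zero {s : Set ℝ} (h : ∀ x ∈ Set.Icc (0 : ℝ) 1, x ∉ s) :
    unitMeasure s = 0 := by
  rw [unitMeasure_congr (t := ∅) (fun x hx => by simpa using h x hx), measure_empty]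

lemma unitMeasure_eq_one {s : Set ℝ} (h : ∀ x ∈ Set.Icc (0 : ℝ) 1, x ∈ s) :
    unitMeasure s = 1 := by
  rw [unitMeasure_congr (t := Set.univ) (fun x hx => by simpa using h x hx), unitMeasure_univ]

lemma map_one_sub_unitMeasure : unitMeasure.map (fun x => 1 - x) = unitMeasure := by
  have hm : Measurable fun x : ℝ => 1 - x := by fun_prop
  have : IsProbabilityMeasure (unitMeasure.map (fun x => 1 - x)) :=
    Measure.isProbabilityMeasure_map hm.aemeasurable
  refine Measure.ext_of_Iic _ _ fun b => ?_
  rw [Measure.map_apply hm measurableSet_Iic]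
  have e : (fun x : ℝ => 1 - x) ⁻¹' Set.Iic b = Set.Ici (1 - b) := by
    ext x
    simp only [Set.mem_preimage, Set.mem_Iic, Set.mem_Ici]
    constructor <;> intro h <;> linarith
  rw [e]
  rcases le_total b 1 with h1 | h1
  · rw [unitMeasure_Ici (by linarith), unitMeasure_Iic h1]
    rcases le_total 0 b with h0 | h0
    · rw [q_one_sub h0 h1, sub_sub_cancel]
    · rw [ENNReal.ofReal_of_nonpos (q_nonpos h0), ENNReal.ofReal_of_nonpos]
      have := monotone_q (show 1 ≤ 1 - b by linarith)
      rw [q_one] at this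
      linarith
  · rw [unitMeasure_eq_one (s := Set.Iic b) fun x hx => hx.2.trans h1]
    exact unitMeasure_eq_one fun x hx => (by linarith : 1 - b ≤ 0).trans hx.1

/-- Self-similarity: `q` maps `x / (1 + x)` to `q x / 2` and `1 / (1 + x)` to `1 - q x / 2`, so the
measure is the average of its images under the two branches `x ↦ x / (1 + x)` and
`x ↦ 1 / (1 + x)`. -/
lemma unitMeasure_self_similar :
    unitMeasure = (2⁻¹ : ENNReal) • (unitMeasure.map (fun x => x / (1 + x)) +
      unitMeasure.map (fun x => 1 / (1 + x))) := by
  have hm1 : Measurable fun x : ℝ => x / (1 + x) := by fun_prop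
  have hm2 : Measurable fun x : ℝ => 1 / (1 + x) := by fun_prop
  refine Measure.ext_of_Iic _ _ fun b => ?_
  rw [Measure.smul_apply, Measure.add_apply, Measure.map_apply hm1 measurableSet_Iic,
    Measure.map_apply hm2 measurableSet_Iic, smul_eq_mul]
  have hhalf : (2⁻¹ : ENNReal) = ENNReal.ofReal (1 / 2) := by
    rw [one_div, ENNReal.ofReal_inv_of_pos two_pos, ENNReal.ofReal_ofNat]
  rcases lt_or_ge b 0 with hb0 | hb0
  · rw [unitMeasure_eq_zero fun x hx h => ?_, unitMeasure_eq_zero fun x hx h => ?_,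
      unitMeasure_eq_zero fun x hx h => ?_]
    · simp
    · have : 0 ≤ 1 / (1 + x) := by have := hx.1; positivity
      exact absurd (this.trans h) (not_le.mpr hb0)
    · have : 0 ≤ x / (1 + x) := by have := hx.1; positivity
      exact absurd (this.trans h) (not_le.mpr hb0)
    · exact absurd (hx.1.trans h) (not_le.mpr hb0)
  rcases le_or_gt b (1 / 2) with hb1 | hb1
  · have hb : 0 < 1 - b := by linarith
    have hc0 : 0 ≤ b / (1 - b) := by positivity
    have hc1 : b / (1 - b) ≤ 1 := by rw [div_le_one hb]; linarith
    have e : b / (1 - b) / (1 + b / (1 - b)) = b := by field_simp; ring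
    have h2 := q_div_one_add hc0 hc1
    rw [e] at h2
    have h3 : unitMeasure ((fun x : ℝ => 1 / (1 + x)) ⁻¹' Set.Iic b) = 0 := by
      refine le_antisymm ?_ zero_le
      have := unitMeasure_Ici zero_le_one
      rw [q_one, sub_self, ENNReal.ofReal_zero] at this
      rw [← this]
      rw [unitMeasure_congr (t := (fun x : ℝ => 1 / (1 + x)) ⁻¹' Set.Iic b ∩ Set.Icc 0 1)
        (fun x hx => by simp [hx.1, hx.2])]
      refine measure_mono fun x ⟨hx, hx'⟩ => ?_
      have hx0 := hx'.1
      have : 1 / (1 + x) ≤ 1 / 2 := le_trans hx hb1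
      rw [div_le_div_iff₀ (by linarith) two_pos] at this
      exact (by linarith : (1 : ℝ) ≤ x)
    have h4 : unitMeasure ((fun x : ℝ => x / (1 + x)) ⁻¹' Set.Iic b) =
        unitMeasure (Set.Iic (b / (1 - b))) := by
      refine unitMeasure_congr fun x hx => ?_
      have hx0 := hx.1
      simp only [Set.mem_preimage, Set.mem_Iic]
      rw [div_le_iff₀ (by linarith), le_div_iff₀ hb]
      constructor <;> intro h <;> linarith
    rw [h3, h4, unitMeasure_Iic hc1, unitMeasure_Iic (by linarith), h2, add_zero, hhalf,
      ← ENNReal.ofReal_mul (by norm_num)]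
    congr 1
    ring
  · have h1 : unitMeasure ((fun x : ℝ => x / (1 + x)) ⁻¹' Set.Iic b) = 1 := by
      refine unitMeasure_eq_one fun x hx => ?_
      refine le_trans ?_ hb1.le
      have hx0 := hx.1
      rw [div_le_div_iff₀ (by linarith) two_pos]
      linarith [hx.2]
    rw [h1]
    rcases le_total b 1 with hb2 | hb2
    · have hb : 0 < b := by linarith
      have hc0 : 0 ≤ (1 - b) / b := div_nonneg (by linarith) hb.le
      have hc1 : (1 - b) / b ≤ 1 := by rw [div_le_one hb]; linarith
      have e : 1 / (1 + (1 - b) / b) = b := by field_simp; ring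
      have h2 := q_one_div_one_add hc0 hc1
      have h3 := monotone_q hc1
      rw [q_one] at h3
      rw [e] at h2
      have h4 : unitMeasure ((fun x : ℝ => 1 / (1 + x)) ⁻¹' Set.Iic b) =
          unitMeasure (Set.Ici ((1 - b) / b)) := by
        refine unitMeasure_congr fun x hx => ?_
        have hx0 := hx.1
        simp only [Set.mem_preimage, Set.mem_Iic, Set.mem_Ici]
        rw [div_le_iff₀ (by linarith), div_le_iff₀ hb]
        constructor <;> intro h <;> linarith
      rw [h4, unitMeasure_Ici hc0, unitMeasure_Iic hb2, h2, ← ENNReal.ofReal_one,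
        ← ENNReal.ofReal_add zero_le_one (by linarith), hhalf, ← ENNReal.ofReal_mul (by norm_num)]
      congr 1
      ring
    · have h4 : unitMeasure ((fun x : ℝ => 1 / (1 + x)) ⁻¹' Set.Iic b) = 1 := by
        refine unitMeasure_eq_one fun x hx => le_trans ?_ hb2
        have hx0 := hx.1
        rw [div_le_one (by linarith)]
        linarith
      rw [h4, unitMeasure_eq_one (s := Set.Iic b) fun x hx => hx.2.trans hb2,
        one_add_one_eq_two, ENNReal.inv_mul_cancel two_ne_zero ENNReal.ofNat_ne_top]

lemma integral_self_similar {E : Type*} [NormedAddCommGroup E] [NormedSpace ℝ E] {g : ℝ → E}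
    (hg : Integrable g unitMeasure) :
    Integrable (fun x => g (x / (1 + x))) unitMeasure ∧
    Integrable (fun x => g (1 / (1 + x))) unitMeasure ∧
    ∫ x, g x ∂unitMeasure = (1 / 2 : ℝ) • ((∫ x, g (x / (1 + x)) ∂unitMeasure) +
      ∫ x, g (1 / (1 + x)) ∂unitMeasure) := by
  have hm1 : Measurable fun x : ℝ => x / (1 + x) := by fun_prop
  have hm2 : Measurable fun x : ℝ => 1 / (1 + x) := by fun_prop
  have h := hg
  rw [unitMeasure_self_similar, integrable_smul_measure (by simp) (by simp),
    integrable_add_measure] at h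
  obtain ⟨h1, h2⟩ := h
  refine ⟨h1.comp_measurable hm1, h2.comp_measurable hm2, ?_⟩
  rw [← integral_map hm1.aemeasurable h1.1, ← integral_map hm2.aemeasurable h2.1]
  conv_lhs => rw [unitMeasure_self_similar]
  rw [integral_smul_measure, integral_add_measure h1 h2]
  simp

lemma integral_comp_one_sub {E : Type*} [NormedAddCommGroup E] [NormedSpace ℝ E] {g : ℝ → E}
    (hg : Continuous g) :
    ∫ x, g (1 - x) ∂unitMeasure = ∫ x, g x ∂unitMeasure := by
  have hm : Measurable fun x : ℝ => 1 - x := by fun_prop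
  conv_rhs => rw [← map_one_sub_unitMeasure]
  rw [integral_map hm.aemeasurable hg.aestronglyMeasurable]

lemma integrable_of_continuous {E : Type*} [NormedAddCommGroup E] {g : ℝ → E}
    (hg : Continuous g) : Integrable g unitMeasure := by
  obtain ⟨C, hC⟩ := isCompact_Icc.exists_bound_of_continuousOn (s := Set.Icc (0 : ℝ) 1)
    hg.continuousOn
  refine Integrable.of_bound hg.aestronglyMeasurable C ?_
  filter_upwards [ae_mem_Icc] with x hx using hC x hx

lemma integrable_min_inv_sq (N : ℕ) :
    Integrable (fun x : ℝ => (min x⁻¹ N) ^ 2) unitMeasure := by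
  refine Integrable.of_bound (by fun_prop) ((N : ℝ) ^ 2) ?_
  filter_upwards [ae_mem_Icc] with x hx
  have h0 : 0 ≤ min x⁻¹ (N : ℝ) := le_min (inv_nonneg.mpr hx.1) N.cast_nonneg
  rw [Real.norm_of_nonneg (by positivity)]
  gcongr
  exact min_le_right _ _

/-- All the mass near `0` comes through the branch `x ↦ x / (1 + x)`, which raises `1 / x` by `1`
and halves the mass; this bounds the second moment of the truncations `min (1 / x) N`. -/
lemma integral_min_inv_sq_le (N : ℕ) : ∫ x, (min x⁻¹ N) ^ 2 ∂unitMeasure ≤ 14 := by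
  have hint := integrable_min_inv_sq N
  obtain ⟨h1, h2, h3⟩ := integral_self_similar hint
  have b1 : ∫ x, (min (x / (1 + x))⁻¹ N) ^ 2 ∂unitMeasure ≤
      ∫ x, (3 + 3 / 2 * (min x⁻¹ N) ^ 2 : ℝ) ∂unitMeasure := by
    refine integral_mono_ae h1 ((integrable_const _).add (hint.const_mul _)) ?_
    filter_upwards [ae_mem_Ioc] with x hx
    have hx0 := hx.1
    have e : (x / (1 + x))⁻¹ = x⁻¹ + 1 := by field_simp
    have h0 : 0 ≤ min (x / (1 + x))⁻¹ (N : ℝ) := le_min (by positivity) N.cast_nonneg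
    have h4 : min (x / (1 + x))⁻¹ (N : ℝ) ≤ min x⁻¹ N + 1 := by
      rw [e, ← min_add_add_right]
      exact min_le_min le_rfl (by linarith)
    have h5 := pow_le_pow_left₀ h0 h4 2
    -- `(m + 1) ^ 2 ≤ 3 + (3 / 2) m ^ 2`; the factor `3 / 2 < 2` lets the halving absorb this term.
    nlinarith [sq_nonneg (min x⁻¹ (N : ℝ) - 2)]
  have b2 : ∫ x, (min (1 / (1 + x))⁻¹ N) ^ 2 ∂unitMeasure ≤ ∫ _, (4 : ℝ) ∂unitMeasure := by
    refine integral_mono_ae h2 (integrable_const _) ?_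
    filter_upwards [ae_mem_Ioc] with x hx
    have hx0 := hx.1
    have h0 : 0 ≤ min (1 / (1 + x))⁻¹ (N : ℝ) := le_min (by positivity) N.cast_nonneg
    have h4 : min (1 / (1 + x))⁻¹ (N : ℝ) ≤ 2 := by
      refine (min_le_left _ _).trans ?_
      rw [one_div, inv_inv]
      linarith [hx.2]
    nlinarith
  rw [integral_add (integrable_const _) (hint.const_mul _), integral_const_mul] at b1
  simp only [integral_const, probReal_univ, smul_eq_mul, one_mul] at b1 b2 h3
  linarith

/-- Fatou's lemma applied to the truncations. -/
lemma integrable_inv_sq : Integrable (fun x : ℝ => (x⁻¹) ^ 2) unitMeasure := by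
  have hmeas : Measurable fun x : ℝ => (x⁻¹) ^ 2 := by fun_prop
  refine ⟨hmeas.aestronglyMeasurable, ?_⟩
  have hlim : ∀ x : ℝ, Tendsto (fun N : ℕ => ‖(min x⁻¹ (N : ℝ)) ^ 2‖ₑ) atTop (𝓝 ‖(x⁻¹) ^ 2‖ₑ) := by
    intro x
    refine tendsto_const_nhds.congr' ?_
    obtain ⟨N, hN⟩ := exists_nat_ge x⁻¹
    filter_upwards [eventually_ge_atTop N] with M hM
    rw [min_eq_left (hN.trans (by exact_mod_cast hM))]
  have hfat := lintegral_liminf_le (μ := unitMeasure) (u := atTop)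
    (f := fun (N : ℕ) (x : ℝ) => ‖(min x⁻¹ (N : ℝ)) ^ 2‖ₑ) (fun N => by fun_prop)
  simp_rw [fun x => (hlim x).liminf_eq] at hfat
  refine lt_of_le_of_lt (hfat.trans ?_) (ENNReal.ofReal_lt_top (r := 14))
  refine liminf_le_of_le (f := atTop) (by isBoundedDefault) fun b hb => ?_
  obtain ⟨N, hN⟩ := hb.exists
  refine hN.trans ?_
  have hint := integrable_min_inv_sq N
  rw [← ofReal_integral_norm_eq_lintegral_enorm hint]
  refine ENNReal.ofReal_le_ofReal (le_trans (le_of_eq ?_) (integral_min_inv_sq_le N))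
  congr with x
  simp

lemma integrable_inv : Integrable (fun x : ℝ => x⁻¹) unitMeasure := by
  refine integrable_inv_sq.mono' (by fun_prop) ?_
  filter_upwards [ae_mem_Ioc] with x hx
  have hx0 := hx.1
  have : 1 ≤ x⁻¹ := (one_le_inv₀ hx0).mpr hx.2
  rw [Real.norm_of_nonneg (by positivity)]
  nlinarith

/-- The two branches turn `1 / x` into `1 / x + 1` and `1 + x`, and `exp (-I a ·)` has period `1`,
so self-similarity expresses the integral of `exp (-I a / x) / x` through that of
`(2 + x) exp (-I a x)`. -/
lemma integral_exp_inv_mul_inv {a : ℝ} (ha : Complex.exp (-(Complex.I * a)) = 1) :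
    ∫ x : ℝ, (x : ℂ)⁻¹ * Complex.exp (-(Complex.I * a * (x : ℂ)⁻¹)) ∂unitMeasure =
      ∫ x : ℝ, (2 + x : ℂ) * Complex.exp (-(Complex.I * a * x)) ∂unitMeasure := by
  have hnorm (x : ℝ) : ‖Complex.exp (-(Complex.I * a * x))‖ = 1 := by
    rw [show -(Complex.I * a * x) = ((-(a * x) : ℝ) : ℂ) * Complex.I by push_cast; ring,
      Complex.norm_exp_ofReal_mul_I]
  have hnorm' (x : ℝ) : ‖Complex.exp (-(Complex.I * a * (x : ℂ)⁻¹))‖ = 1 := by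
    rw [← Complex.ofReal_inv, hnorm]
  have i0 : Integrable (fun x : ℝ => Complex.exp (-(Complex.I * a * (x : ℂ)⁻¹))) unitMeasure := by
    refine Integrable.of_bound (by fun_prop) 1 (Eventually.of_forall fun x => ?_)
    rw [hnorm']
  have i1 : Integrable (fun x : ℝ => (x : ℂ)⁻¹ * Complex.exp (-(Complex.I * a * (x : ℂ)⁻¹)))
      unitMeasure := by
    refine integrable_inv.norm.mono' (by fun_prop) (Eventually.of_forall fun x => ?_)
    rw [norm_mul, hnorm', mul_one, norm_inv, norm_inv, Complex.norm_real]
  have e1 {x : ℝ} (hx : x ∈ Set.Ioc (0 : ℝ) 1) :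
      Complex.exp (-(Complex.I * a * ((x / (1 + x) : ℝ) : ℂ)⁻¹)) =
        Complex.exp (-(Complex.I * a * (x : ℂ)⁻¹)) := by
    have hx0 := hx.1
    have : (((x / (1 + x) : ℝ) : ℂ)⁻¹) = (x : ℂ)⁻¹ + 1 := by
      rw [← Complex.ofReal_inv, ← Complex.ofReal_inv, ← Complex.ofReal_one, ← Complex.ofReal_add]
      congr 1
      field_simp
    rw [this, mul_add, neg_add, Complex.exp_add, mul_one, ha, mul_one]
  have e2 {x : ℝ} (hx : x ∈ Set.Ioc (0 : ℝ) 1) :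
      Complex.exp (-(Complex.I * a * ((1 / (1 + x) : ℝ) : ℂ)⁻¹)) =
        Complex.exp (-(Complex.I * a * (x : ℂ))) := by
    rw [one_div, Complex.ofReal_inv, inv_inv]
    push_cast
    rw [mul_add, neg_add, Complex.exp_add, mul_one, ha, one_mul]
  have c0 : Integrable (fun x : ℝ => Complex.exp (-(Complex.I * a * (x : ℂ)))) unitMeasure :=
    integrable_of_continuous (by fun_prop)
  have c1 : Integrable (fun x : ℝ => (1 + x : ℂ) * Complex.exp (-(Complex.I * a * (x : ℂ))))
      unitMeasure := integrable_of_continuous (by fun_prop)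
  obtain ⟨-, -, s0⟩ := integral_self_similar i0
  obtain ⟨-, -, s1⟩ := integral_self_similar i1
  rw [integral_congr_ae (f := fun x : ℝ => Complex.exp (-(Complex.I * a * ((x / (1 + x) : ℝ) : ℂ)⁻¹)))
      (g := fun x : ℝ => Complex.exp (-(Complex.I * a * (x : ℂ)⁻¹)))
      (by filter_upwards [ae_mem_Ioc] with x hx using e1 hx),
    integral_congr_ae (f := fun x : ℝ => Complex.exp (-(Complex.I * a * ((1 / (1 + x) : ℝ) : ℂ)⁻¹)))
      (g := fun x : ℝ => Complex.exp (-(Complex.I * a * (x : ℂ))))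
      (by filter_upwards [ae_mem_Ioc] with x hx using e2 hx)] at s0
  rw [integral_congr_ae (f := fun x : ℝ => (((x / (1 + x) : ℝ) : ℂ)⁻¹) *
        Complex.exp (-(Complex.I * a * ((x / (1 + x) : ℝ) : ℂ)⁻¹)))
      (g := fun x : ℝ => (x : ℂ)⁻¹ * Complex.exp (-(Complex.I * a * (x : ℂ)⁻¹)) +
      Complex.exp (-(Complex.I * a * (x : ℂ)⁻¹))) ?_,
    integral_congr_ae (f := fun x : ℝ => (((1 / (1 + x) : ℝ) : ℂ)⁻¹) *
        Complex.exp (-(Complex.I * a * ((1 / (1 + x) : ℝ) : ℂ)⁻¹)))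
      (g := fun x : ℝ => (1 + x : ℂ) * Complex.exp (-(Complex.I * a * (x : ℂ)))) ?_,
    integral_add i1 i0] at s1
  · have e3 : ∫ x : ℝ, (2 + x : ℂ) * Complex.exp (-(Complex.I * a * x)) ∂unitMeasure =
        (∫ x : ℝ, Complex.exp (-(Complex.I * a * x)) ∂unitMeasure) +
        ∫ x : ℝ, (1 + x : ℂ) * Complex.exp (-(Complex.I * a * x)) ∂unitMeasure := by
      rw [← integral_add c0 c1]
      congr with x
      ring
    rw [e3]
    simp only [Complex.real_smul] at s0 s1
    push_cast at s0 s1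
    linear_combination 2 * s1 + 2 * s0
  · filter_upwards [ae_mem_Ioc] with x hx
    rw [e2 hx, one_div, Complex.ofReal_inv, inv_inv]
    push_cast
    rfl
  · filter_upwards [ae_mem_Ioc] with x hx
    have hx0 := hx.1
    have : (((x / (1 + x) : ℝ) : ℂ)⁻¹) = (x : ℂ)⁻¹ + 1 := by
      rw [← Complex.ofReal_inv, ← Complex.ofReal_inv, ← Complex.ofReal_one, ← Complex.ofReal_add]
      congr 1
      field_simp
    rw [e1 hx, this]
    ring

/-! ### The Bessel–Clifford functions -/

/-- The Bessel–Clifford function of order `m` at `-x`, that is `∑ (-x)^k / (k! (m + k)!)`. It is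
`x ^ (-m / 2)` times the Bessel function `J_m (2 √x)` for `x > 0`. -/
noncomputable def clifford (m : ℕ) (x : ℝ) : ℝ :=
  ∑' k : ℕ, (-x) ^ k / (k.factorial * (m + k).factorial : ℝ)

lemma abs_clifford_term_le (m k : ℕ) (x : ℝ) :
    |(-x) ^ k / (k.factorial * (m + k).factorial : ℝ)| ≤ |x| ^ k / k.factorial := by
  have h1 : (0 : ℝ) < k.factorial := by positivity
  have h2 : (1 : ℝ) ≤ (m + k).factorial := by
    exact_mod_cast Nat.one_le_iff_ne_zero.mpr (Nat.factorial_ne_zero _)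
  rw [abs_div, abs_pow, abs_neg, abs_of_pos (a := (k.factorial * (m + k).factorial : ℝ))
    (by positivity)]
  gcongr
  exact le_mul_of_one_le_right h1.le h2

lemma summable_clifford_term (m : ℕ) (x : ℝ) :
    Summable fun k : ℕ => (-x) ^ k / (k.factorial * (m + k).factorial : ℝ) :=
  Summable.of_norm_bounded (Real.summable_pow_div_factorial |x|)
    fun k => abs_clifford_term_le m k x

lemma J0_two_mul_sqrt {x : ℝ} (hx : 0 ≤ x) : J0 (2 * √x) = clifford 0 x := by
  unfold J0 clifford
  congr with k
  rw [mul_div_cancel_left₀ _ two_ne_zero, pow_mul, Real.sq_sqrt hx, neg_pow, zero_add, sq]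
  ring

lemma hasDerivAt_clifford (m : ℕ) (x : ℝ) :
    HasDerivAt (clifford m) (-clifford (m + 1) x) x := by
  set R : ℝ := |x| + 1
  have hR : 0 ≤ R := by positivity
  have hu : Summable fun k : ℕ => (k * R ^ (k - 1) / k.factorial : ℝ) := by
    rw [← summable_nat_add_iff 1]
    refine (Real.summable_pow_div_factorial R).congr fun k => ?_
    rw [Nat.add_sub_cancel, Nat.factorial_succ]
    push_cast
    field_simp
  have hx : x ∈ Metric.ball (0 : ℝ) R := by
    rw [mem_ball_zero_iff, Real.norm_eq_abs]
    exact lt_add_one _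
  have hbound (k : ℕ) (y : ℝ) (hy : y ∈ Metric.ball (0 : ℝ) R) :
      ‖k * (-y) ^ (k - 1) * (-1) / (k.factorial * (m + k).factorial : ℝ)‖ ≤
        k * R ^ (k - 1) / k.factorial := by
    rw [mem_ball_zero_iff, Real.norm_eq_abs] at hy
    have h1 : (0 : ℝ) < k.factorial := by positivity
    have h2 : (1 : ℝ) ≤ (m + k).factorial := by
      exact_mod_cast Nat.one_le_iff_ne_zero.mpr (Nat.factorial_ne_zero _)
    rw [Real.norm_eq_abs, abs_div, abs_mul, abs_mul, abs_pow, abs_neg, abs_neg, abs_one, mul_one,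
      Nat.abs_cast, abs_of_pos (a := (k.factorial * (m + k).factorial : ℝ)) (by positivity)]
    gcongr
    exact le_mul_of_one_le_right h1.le h2
  have h := hasDerivAt_tsum_of_isPreconnected
    (g := fun (k : ℕ) (x : ℝ) => (-x) ^ k / (k.factorial * (m + k).factorial : ℝ))
    (g' := fun (k : ℕ) (x : ℝ) => k * (-x) ^ (k - 1) * (-1) / (k.factorial * (m + k).factorial : ℝ))
    hu Metric.isOpen_ball (convex_ball (0 : ℝ) R).isPreconnected
    (fun k y _ => ((hasDerivAt_neg y).pow k).div_const _) hbound hx (summable_clifford_term m x) hx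
  have e : ∑' k : ℕ, k * (-x) ^ (k - 1) * (-1) / (k.factorial * (m + k).factorial : ℝ) =
      -clifford (m + 1) x := by
    rw [(Summable.of_norm_bounded hu fun k => hbound k x hx).tsum_eq_zero_add, clifford, ← tsum_neg]
    simp only [Nat.cast_zero, zero_mul, zero_div, zero_add]
    congr with k
    rw [Nat.add_sub_cancel, Nat.factorial_succ, show m + (k + 1) = m + 1 + k by ring]
    push_cast
    field_simp
  rw [e] at h
  exact h

lemma continuous_clifford (m : ℕ) : Continuous (clifford m) :=
  continuous_iff_continuousAt.mpr fun x => (hasDerivAt_clifford m x).continuousAt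

lemma clifford_zero_right (m : ℕ) : clifford m 0 = 1 / m.factorial := by
  unfold clifford
  rw [tsum_eq_single 0 fun k hk => by simp [hk]]
  simp

/-- The Bessel differential equation `x y'' + y' + y = 0` of `y = clifford 0`. -/
lemma mul_clifford_two (x : ℝ) : x * clifford 2 x = clifford 1 x - clifford 0 x := by
  unfold clifford
  rw [← (summable_clifford_term 1 x).tsum_sub (summable_clifford_term 0 x), ← tsum_mul_left,
    ((summable_clifford_term 1 x).sub (summable_clifford_term 0 x)).tsum_eq_zero_add]
  simp only [pow_zero, Nat.factorial_zero, add_zero, Nat.factorial_one, sub_self, zero_add]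
  congr with k
  rw [show 2 + k = k + 1 + 1 by ring, show 1 + (k + 1) = k + 1 + 1 by ring]
  simp only [Nat.factorial_succ, pow_succ]
  push_cast
  field_simp
  ring

/-- Decay at infinity. With `y = clifford 0`, the energy
`((x y' + y / 4) ^ 2 + (x + 1 / 16) y ^ 2) / √x` has derivative `- y ^ 2 / (16 x √x) ≤ 0`. -/
lemma exists_clifford_bound : ∃ C : ℝ, 0 ≤ C ∧ ∀ x : ℝ, 1 ≤ x →
    |clifford 0 x| ≤ C * x ^ (-(1 / 4) : ℝ) ∧ |clifford 1 x| ≤ C * x ^ (-(1 / 4) : ℝ) ∧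
    |clifford 2 x| ≤ 2 * C * x ^ (-(5 / 4) : ℝ) := by
  set N : ℝ → ℝ := fun x =>
    (-(x * clifford 1 x) + clifford 0 x / 4) ^ 2 + (x + 1 / 16) * clifford 0 x ^ 2 with hN
  have hd {x : ℝ} (hx : 0 < x) : HasDerivAt (fun x => N x / √x)
      (-(clifford 0 x ^ 2 / (16 * x * √x))) x := by
    have h0 := hasDerivAt_clifford 0 x
    have h1 := hasDerivAt_clifford 1 x
    have hs := Real.hasDerivAt_sqrt hx.ne'
    have hsx : √x ≠ 0 := (Real.sqrt_pos.mpr hx).ne'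
    have hsq : √x ^ 2 = x := Real.sq_sqrt hx.le
    have h2 := mul_clifford_two x
    have h2' : clifford 2 x = (clifford 1 x - clifford 0 x) / x := by
      rw [← h2]; field_simp
    refine ((((((hasDerivAt_id x).mul h1).neg.add (h0.div_const 4)).pow 2).add
      (((hasDerivAt_id x).add_const (1 / 16)).mul (h0.pow 2))).div hs hsx).congr_deriv ?_
    simp only [id, Pi.add_apply, Pi.neg_apply, Pi.mul_apply, Pi.pow_apply, zero_add, Nat.reduceAdd]
    rw [h2', hsq]
    field_simp
    rw [hsq]
    ring
  have hanti : AntitoneOn (fun x => N x / √x) (Set.Ici 1) := by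
    refine antitoneOn_of_deriv_nonpos (convex_Ici 1)
      (fun x hx => (hd (zero_lt_one.trans_le hx)).continuousAt.continuousWithinAt) ?_ ?_
    · rw [interior_Ici]
      exact fun x hx =>
        (hd (zero_lt_one.trans hx)).differentiableAt.differentiableWithinAt
    · rw [interior_Ici]
      intro x hx
      have : 0 < x := zero_lt_one.trans hx
      rw [(hd this).deriv, neg_nonpos]
      positivity
  set M := N 1
  have hM : 0 ≤ M := by simp only [M, hN]; positivity
  -- With `r = x ^ (1 / 4)`, the energy bound gives `|r y| ≤ √M` and `|x y' + y / 4| ≤ √M r`; the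
  -- differential equation then bounds `x y''`.
  refine ⟨2 * √M, by positivity, fun x hx => ?_⟩
  have hx0 : 0 < x := zero_lt_one.trans_le hx
  have hle : N x ≤ M * √x := by
    have := hanti (Set.mem_Ici.mpr le_rfl) (Set.mem_Ici.mpr hx) hx
    simp only [Real.sqrt_one, div_one] at this
    rwa [div_le_iff₀ (Real.sqrt_pos.mpr hx0)] at this
  set r : ℝ := x ^ (1 / 4 : ℝ)
  have hr : 0 < r := by positivity
  have hr1 : 1 ≤ r := Real.one_le_rpow hx (by norm_num)
  have hr4 : x = r ^ 4 := by
    rw [← Real.rpow_natCast, ← Real.rpow_mul hx0.le]; norm_num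
  have hr2 : √x = r ^ 2 := by
    rw [hr4, show r ^ 4 = (r ^ 2) ^ 2 by ring, Real.sqrt_sq (by positivity)]
  have hri : x ^ (-(1 / 4) : ℝ) = r⁻¹ := Real.rpow_neg hx0.le _
  have hri5 : x ^ (-(5 / 4) : ℝ) = r⁻¹ / x := by
    rw [← hri, ← Real.rpow_sub_one hx0.ne']; norm_num
  rw [hr2] at hle
  have e0 : |r * clifford 0 x| ≤ √M := by
    refine Real.abs_le_sqrt ?_
    have : r ^ 4 * clifford 0 x ^ 2 ≤ M * r ^ 2 := by
      refine le_trans ?_ hle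
      simp only [hN]
      rw [← hr4]
      nlinarith [sq_nonneg (-(x * clifford 1 x) + clifford 0 x / 4), sq_nonneg (clifford 0 x)]
    refine le_of_mul_le_mul_left ?_ (by positivity : 0 < r ^ 2)
    linarith
  have e1 : |-(x * clifford 1 x) + clifford 0 x / 4| ≤ √M * r := by
    rw [← Real.sqrt_sq hr.le, ← Real.sqrt_mul hM]
    refine Real.abs_le_sqrt (le_trans ?_ hle)
    simp only [hN]
    have : 0 ≤ (x + 1 / 16) * clifford 0 x ^ 2 := by positivity
    linarith
  have b0 : |clifford 0 x| ≤ √M * r⁻¹ := by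
    rw [abs_mul, abs_of_pos hr] at e0
    rw [← div_eq_mul_inv, le_div_iff₀ hr]
    linarith
  have b0' : |clifford 0 x| ≤ √M * r := by
    refine b0.trans (mul_le_mul_of_nonneg_left ?_ (Real.sqrt_nonneg _))
    exact (inv_le_one_of_one_le₀ hr1).trans hr1
  have b1 : |clifford 1 x| ≤ 2 * √M * r⁻¹ := by
    have h1 : |x * clifford 1 x| ≤ 2 * √M * r := by
      rw [abs_le] at e1 b0' ⊢
      have : 0 ≤ √M * r := by positivity
      constructor <;> linarith [e1.1, e1.2, b0'.1, b0'.2]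
    rw [abs_mul, abs_of_pos hx0, hr4] at h1
    have h2 : r ^ 2 * |clifford 1 x| ≤ r ^ 4 * |clifford 1 x| := by
      refine mul_le_mul_of_nonneg_right ?_ (abs_nonneg _)
      exact pow_le_pow_right₀ hr1 (by norm_num)
    rw [← div_eq_mul_inv, le_div_iff₀ hr]
    rw [← hr4] at h1 h2
    refine le_of_mul_le_mul_left ?_ hr
    linarith
  have hM' : 0 ≤ √M * r⁻¹ := by positivity
  rw [hri, hri5]
  refine ⟨by linarith, b1, ?_⟩
  rw [← mul_div_assoc, le_div_iff₀ hx0, ← abs_of_pos hx0, ← abs_mul, abs_of_pos hx0, mul_comm,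
    mul_clifford_two]
  refine (abs_sub _ _).trans ?_
  linarith

lemma exists_clifford_le (m : ℕ) (hm : m ≤ 1) : ∃ K : ℝ, ∀ x : ℝ, 0 ≤ x → |clifford m x| ≤ K := by
  obtain ⟨C, hC, h⟩ := exists_clifford_bound
  obtain ⟨K, hK⟩ := isCompact_Icc.exists_bound_of_continuousOn (s := Set.Icc (0 : ℝ) 1)
    (continuous_clifford m).continuousOn
  refine ⟨max C K, fun x hx => ?_⟩
  rcases le_total x 1 with hx1 | hx1
  · exact (hK x ⟨hx, hx1⟩).trans (le_max_right _ _)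
  · refine le_trans ?_ (le_max_left _ _)
    have h1 : C * x ^ (-(1 / 4) : ℝ) ≤ C :=
      mul_le_of_le_one_right hC (Real.rpow_le_one_of_one_le_of_nonpos hx1 (by norm_num))
    interval_cases m
    · exact (h x hx1).1.trans h1
    · exact (h x hx1).2.1.trans h1

lemma tendsto_clifford (m : ℕ) (hm : m ≤ 1) : Tendsto (clifford m) atTop (𝓝 0) := by
  obtain ⟨C, hC, h⟩ := exists_clifford_bound
  have h0 : Tendsto (fun x : ℝ => C * x ^ (-(1 / 4) : ℝ)) atTop (𝓝 0) := by
    simpa using (tendsto_rpow_neg_atTop (by norm_num : (0 : ℝ) < 1 / 4)).const_mul C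
  refine squeeze_zero_norm' ?_ h0
  filter_upwards [eventually_ge_atTop 1] with x hx
  interval_cases m
  · exact (h x hx).1
  · exact (h x hx).2.1

lemma integrableOn_clifford_two : IntegrableOn (clifford 2) (Set.Ioi 0) := by
  obtain ⟨C, hC, h⟩ := exists_clifford_bound
  rw [← Set.Ioc_union_Ioi_eq_Ioi zero_le_one]
  refine IntegrableOn.union ?_ ?_
  · exact ((continuous_clifford 2).integrableOn_Icc).mono_set Set.Ioc_subset_Icc_self
  · refine ((integrableOn_Ioi_rpow_of_lt (by norm_num : -(5 / 4) < (-1 : ℝ))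
      zero_lt_one).const_mul (2 * C)).mono' (continuous_clifford 2).aestronglyMeasurable ?_
    filter_upwards [ae_restrict_mem measurableSet_Ioi] with x hx
    exact (h x (le_of_lt hx)).2.2

/-! ### The Laplace and Fourier transforms of the Bessel function -/

lemma norm_exp_neg_mul_le_one {s : ℂ} (hs : 0 ≤ s.re) {x : ℝ} (hx : 0 ≤ x) :
    ‖Complex.exp (-(s * x))‖ ≤ 1 := by
  rw [Complex.norm_exp, Complex.neg_re, Complex.re_mul_ofReal, Real.exp_le_one_iff, neg_nonpos]
  exact mul_nonneg hs hx

lemma hasDerivAt_exp_neg_mul (s : ℂ) (x : ℝ) :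
    HasDerivAt (fun x : ℝ => Complex.exp (-(s * x))) (-s * Complex.exp (-(s * x))) x := by
  have h := (((hasDerivAt_id x).ofReal_comp.const_mul s).neg).cexp
  simp only [id, Complex.ofReal_one, mul_one] at h
  rw [mul_comm]
  exact h

/-- Two integrations by parts. -/
lemma integral_clifford_mul_exp {s : ℂ} (hs : s ≠ 0) (Y : ℝ) :
    ∫ x in (0 : ℝ)..Y, (clifford 0 x : ℂ) * Complex.exp (-(s * x)) =
      1 / s ^ 2 * (∫ x in (0 : ℝ)..Y, (clifford 2 x : ℂ) * Complex.exp (-(s * x))) +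
      (-(clifford 0 Y / s) + clifford 1 Y / s ^ 2) * Complex.exp (-(s * Y)) +
      (1 / s - 1 / s ^ 2) := by
  have hc (m : ℕ) : Continuous fun x : ℝ => (clifford m x : ℂ) * Complex.exp (-(s * x)) :=
    (Complex.continuous_ofReal.comp (continuous_clifford m)).mul (by fun_prop)
  have hd (x : ℝ) : HasDerivAt (fun x : ℝ => (-((clifford 0 x : ℂ) / s) + clifford 1 x / s ^ 2) *
      Complex.exp (-(s * x)))
      ((clifford 0 x : ℂ) * Complex.exp (-(s * x)) -
        1 / s ^ 2 * ((clifford 2 x : ℂ) * Complex.exp (-(s * x)))) x := by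
    have h := ((((hasDerivAt_clifford 0 x).ofReal_comp.div_const s).neg.add
      ((hasDerivAt_clifford 1 x).ofReal_comp.div_const (s ^ 2))).mul (hasDerivAt_exp_neg_mul s x))
    refine h.congr_deriv ?_
    simp only [Pi.add_apply, Pi.neg_apply, zero_add, Nat.reduceAdd]
    push_cast
    field_simp
    ring
  have h := intervalIntegral.integral_eq_sub_of_hasDerivAt (a := 0) (b := Y) (fun x _ => hd x)
    (((hc 0).sub (continuous_const.mul (hc 2))).intervalIntegrable _ _)
  rw [intervalIntegral.integral_sub ((hc 0).intervalIntegrable _ _)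
    (((hc 2).intervalIntegrable _ _).const_mul _),
    intervalIntegral.integral_const_mul] at h
  rw [sub_eq_iff_eq_add.mp h]
  simp only [clifford_zero_right]
  simp
  ring

lemma integrableOn_clifford_two_mul_exp {s : ℂ} (hs : 0 ≤ s.re) :
    IntegrableOn (fun x : ℝ => (clifford 2 x : ℂ) * Complex.exp (-(s * x))) (Set.Ioi 0) := by
  refine integrableOn_clifford_two.norm.mono' ?_ ?_
  · exact ((Complex.continuous_ofReal.comp (continuous_clifford 2)).mul
      (by fun_prop)).aestronglyMeasurable
  · filter_upwards [ae_restrict_mem measurableSet_Ioi] with x hx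
    rw [norm_mul, Complex.norm_real]
    exact mul_le_of_le_one_right (norm_nonneg _) (norm_exp_neg_mul_le_one hs (le_of_lt hx))

lemma exists_norm_integral_clifford_mul_exp_le : ∃ K : ℝ, ∀ s : ℂ, s ≠ 0 → 0 ≤ s.re →
    ∀ Y : ℝ, 0 ≤ Y → ‖∫ x in (0 : ℝ)..Y, (clifford 0 x : ℂ) * Complex.exp (-(s * x))‖ ≤
      K * (‖s‖⁻¹ + (‖s‖⁻¹) ^ 2) := by
  obtain ⟨K0, h0⟩ := exists_clifford_le 0 (by norm_num)
  obtain ⟨K1, h1⟩ := exists_clifford_le 1 le_rfl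
  set K2 := ∫ x in Set.Ioi (0 : ℝ), ‖clifford 2 x‖
  have hK0 : 0 ≤ K0 := (abs_nonneg _).trans (h0 0 le_rfl)
  have hK1 : 0 ≤ K1 := (abs_nonneg _).trans (h1 0 le_rfl)
  have hK2 : 0 ≤ K2 := integral_nonneg fun _ => norm_nonneg _
  refine ⟨K0 + K1 + K2 + 1, fun s hs hre Y hY => ?_⟩
  rw [integral_clifford_mul_exp hs]
  set r := ‖s‖⁻¹ with hr
  have hr0 : 0 ≤ r := by positivity
  have hn1 : ‖1 / s‖ = r := by rw [one_div, norm_inv]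
  have hn2 : ‖1 / s ^ 2‖ = r ^ 2 := by rw [one_div, norm_inv, norm_pow, inv_pow]
  have b2 : ‖∫ x in (0 : ℝ)..Y, (clifford 2 x : ℂ) * Complex.exp (-(s * x))‖ ≤ K2 := by
    refine (intervalIntegral.norm_integral_le_integral_norm hY).trans ?_
    rw [intervalIntegral.integral_of_le hY]
    refine (setIntegral_mono_set (integrableOn_clifford_two_mul_exp hre).norm
      (Eventually.of_forall fun _ => norm_nonneg _)
      (Set.Ioc_subset_Ioi_self.eventuallyLE)).trans ?_
    refine setIntegral_mono_on (integrableOn_clifford_two_mul_exp hre).norm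
      integrableOn_clifford_two.norm measurableSet_Ioi fun x hx => ?_
    rw [norm_mul, Complex.norm_real]
    exact mul_le_of_le_one_right (norm_nonneg _) (norm_exp_neg_mul_le_one hre (le_of_lt hx))
  have b1 : ‖(-(clifford 0 Y / s) + clifford 1 Y / s ^ 2) * Complex.exp (-(s * Y))‖ ≤
      K0 * r + K1 * r ^ 2 := by
    rw [norm_mul]
    refine (mul_le_of_le_one_right (norm_nonneg _) (norm_exp_neg_mul_le_one hre hY)).trans ?_
    refine (norm_add_le _ _).trans ?_
    rw [norm_neg, norm_div, norm_div, norm_pow, Complex.norm_real, Complex.norm_real,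
      div_eq_mul_inv, div_eq_mul_inv, hr, inv_pow]
    gcongr
    · exact h0 Y hY
    · exact h1 Y hY
  calc _ ≤ r ^ 2 * K2 + (K0 * r + K1 * r ^ 2) + (r + r ^ 2) := by
        refine norm_add_le_of_le (norm_add_le_of_le ?_ b1) ?_
        · rw [norm_mul, hn2]
          gcongr
        · exact (norm_sub_le _ _).trans (by rw [hn1, hn2])
    _ ≤ _ := by nlinarith [mul_nonneg hK0 (sq_nonneg r), mul_nonneg hK1 hr0, mul_nonneg hK2 hr0]

lemma tendsto_integral_clifford_mul_exp {s : ℂ} (hs : s ≠ 0) (hre : 0 ≤ s.re) :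
    Tendsto (fun Y : ℝ => ∫ x in (0 : ℝ)..Y, (clifford 0 x : ℂ) * Complex.exp (-(s * x))) atTop
      (𝓝 (1 / s ^ 2 * (∫ x in Set.Ioi (0 : ℝ), (clifford 2 x : ℂ) * Complex.exp (-(s * x))) +
        (1 / s - 1 / s ^ 2))) := by
  simp_rw [integral_clifford_mul_exp hs]
  have h2 := intervalIntegral_tendsto_integral_Ioi 0 (integrableOn_clifford_two_mul_exp hre)
    tendsto_id
  have ht (m : ℕ) (hm : m ≤ 1) : Tendsto (fun Y : ℝ => (clifford m Y : ℂ)) atTop (𝓝 0) := by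
    rw [← Complex.ofReal_zero]
    exact (Complex.continuous_ofReal.tendsto 0).comp (tendsto_clifford m hm)
  have h1 : Tendsto (fun Y : ℝ => (-((clifford 0 Y : ℂ) / s) + clifford 1 Y / s ^ 2) *
      Complex.exp (-(s * Y))) atTop (𝓝 0) := by
    have h : Tendsto (fun Y : ℝ => -((clifford 0 Y : ℂ) / s) + clifford 1 Y / s ^ 2)
        atTop (𝓝 0) := by
      simpa using ((ht 0 (by norm_num)).div_const s).neg.add ((ht 1 le_rfl).div_const (s ^ 2))
    refine squeeze_zero_norm' ?_ (by simpa using h.norm)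
    filter_upwards [eventually_ge_atTop 0] with Y hY
    rw [norm_mul]
    exact mul_le_of_le_one_right (norm_nonneg _) (norm_exp_neg_mul_le_one hre hY)
  have h := ((h2.const_mul (1 / s ^ 2)).add h1).add_const (1 / s - 1 / s ^ 2)
  rw [add_zero] at h
  exact h

lemma integrableOn_pow_mul_exp (k : ℕ) {b : ℝ} (hb : 0 < b) :
    IntegrableOn (fun x : ℝ => x ^ k * Real.exp (-(b * x))) (Set.Ioi 0) := by
  have h := integrableOn_rpow_mul_exp_neg_mul_rpow (s := k) (p := 1)
    (by linarith [(k.cast_nonneg : (0 : ℝ) ≤ k)]) one_pos hb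
  simpa using h

lemma norm_pow_mul_cexp (k : ℕ) (s : ℂ) {x : ℝ} (hx : 0 ≤ x) :
    ‖(x : ℂ) ^ k * Complex.exp (-(s * x))‖ = x ^ k * Real.exp (-(s.re * x)) := by
  rw [norm_mul, norm_pow, Complex.norm_of_nonneg hx, Complex.norm_exp, Complex.neg_re,
    Complex.re_mul_ofReal]

lemma integrableOn_pow_mul_cexp (k : ℕ) {s : ℂ} (hs : 0 < s.re) :
    IntegrableOn (fun x : ℝ => (x : ℂ) ^ k * Complex.exp (-(s * x))) (Set.Ioi 0) := by
  refine (integrableOn_pow_mul_exp k hs).mono' ?_ ?_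
  · exact Continuous.aestronglyMeasurable (by fun_prop)
  · filter_upwards [ae_restrict_mem measurableSet_Ioi] with x hx
    exact (norm_pow_mul_cexp k s (le_of_lt hx)).le

lemma integral_pow_mul_cexp (k : ℕ) {s : ℂ} (hs : 0 < s.re) :
    ∫ x in Set.Ioi (0 : ℝ), (x : ℂ) ^ k * Complex.exp (-(s * x)) = k.factorial / s ^ (k + 1) := by
  have hs0 : s ≠ 0 := by rintro rfl; simp at hs
  have hlim (k : ℕ) : Tendsto (fun x : ℝ => (x : ℂ) ^ k * Complex.exp (-(s * x))) atTop (𝓝 0) := by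
    have h := tendsto_rpow_mul_exp_neg_mul_atTop_nhds_zero k s.re hs
    refine squeeze_zero_norm' ?_ h
    filter_upwards [eventually_ge_atTop 0] with x hx
    rw [norm_pow_mul_cexp k s hx, Real.rpow_natCast, neg_mul]
  induction k with
  | zero =>
    have h := integral_exp_mul_complex_Ioi (a := -s) (by simpa using hs) 0
    simp only [neg_mul, Complex.ofReal_zero, mul_zero, Complex.exp_zero] at h
    simp [h]
  | succ k ih =>
    have hd (x : ℝ) : HasDerivAt (fun x : ℝ => (x : ℂ) ^ (k + 1) * Complex.exp (-(s * x)))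
        ((k + 1 : ℂ) * ((x : ℂ) ^ k * Complex.exp (-(s * x))) -
          s * ((x : ℂ) ^ (k + 1) * Complex.exp (-(s * x)))) x := by
      have h := ((hasDerivAt_id x).ofReal_comp.pow (k + 1)).mul (hasDerivAt_exp_neg_mul s x)
      refine h.congr_deriv ?_
      simp only [id, Pi.pow_apply, Nat.add_sub_cancel]
      push_cast
      ring
    have h := integral_Ioi_of_hasDerivAt_of_tendsto' (a := 0) (fun x _ => hd x)
      (((integrableOn_pow_mul_cexp k hs).const_mul _).sub
        ((integrableOn_pow_mul_cexp (k + 1) hs).const_mul _)) (hlim (k + 1))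
    rw [integral_sub ((integrableOn_pow_mul_cexp k hs).const_mul _)
      ((integrableOn_pow_mul_cexp (k + 1) hs).const_mul _), integral_const_mul,
      integral_const_mul, ih] at h
    simp only [Complex.ofReal_zero, ne_eq, Nat.add_eq_zero_iff, one_ne_zero, and_false,
      not_false_eq_true, zero_pow, zero_mul, sub_zero] at h
    rw [sub_eq_zero] at h
    rw [← mul_right_inj' hs0, ← h, Nat.factorial_succ, pow_succ s (k + 1)]
    push_cast
    field_simp

/-- The Laplace transform, by termwise integration of the power series. -/
lemma laplace_clifford {s : ℂ} (hs : 0 < s.re) :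
    IntegrableOn (fun x : ℝ => (clifford 0 x : ℂ) * Complex.exp (-(s * x))) (Set.Ioi 0) ∧
    ∫ x in Set.Ioi (0 : ℝ), (clifford 0 x : ℂ) * Complex.exp (-(s * x)) =
      1 / s * Complex.exp (-(1 / s)) := by
  have hs0 : s ≠ 0 := by rintro rfl; simp at hs
  constructor
  · obtain ⟨K, hK⟩ := exists_clifford_le 0 (by norm_num)
    have h := (integrableOn_pow_mul_cexp 0 hs).norm.const_mul K
    refine h.mono' ?_ ?_
    · exact ((Complex.continuous_ofReal.comp (continuous_clifford 0)).mul
        (by fun_prop)).aestronglyMeasurable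
    · filter_upwards [ae_restrict_mem measurableSet_Ioi] with x hx
      rw [norm_mul, Complex.norm_real, pow_zero, one_mul]
      exact mul_le_mul_of_nonneg_right (hK x (le_of_lt hx)) (norm_nonneg _)
  set F : ℕ → ℝ → ℂ := fun k x =>
    ((-1) ^ k / (k.factorial : ℂ) ^ 2) * ((x : ℂ) ^ k * Complex.exp (-(s * x))) with hF
  have hint (k : ℕ) : IntegrableOn (F k) (Set.Ioi 0) :=
    (integrableOn_pow_mul_cexp k hs).const_mul _
  have hnorm (k : ℕ) : ∫ x in Set.Ioi (0 : ℝ), ‖F k x‖ =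
      s.re⁻¹ * ((s.re⁻¹) ^ k / k.factorial) := by
    have hr := Real.integral_rpow_mul_exp_neg_mul_Ioi (a := k + 1) (by positivity) hs
    rw [setIntegral_congr_fun measurableSet_Ioi (g := fun x : ℝ => 1 / (k.factorial : ℝ) ^ 2 *
      (x ^ ((k : ℝ) + 1 - 1) * Real.exp (-(s.re * x)))) fun x hx => ?_, integral_const_mul, hr,
      Real.Gamma_nat_eq_factorial]
    · have h : (s.re⁻¹ : ℝ) ^ ((k : ℝ) + 1) = s.re⁻¹ ^ (k + 1) := by
        rw [← Real.rpow_natCast]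
        push_cast
        rfl
      rw [one_div s.re, h, inv_pow, inv_pow, pow_succ s.re]
      have : (k.factorial : ℝ) ≠ 0 := by positivity
      field_simp
    · simp only [hF]
      rw [norm_mul, norm_pow_mul_cexp k s (le_of_lt hx), add_sub_cancel_right, Real.rpow_natCast]
      simp
  have hsum : Summable fun k => ∫ x in Set.Ioi (0 : ℝ), ‖F k x‖ := by
    simp_rw [hnorm]
    exact (Real.summable_pow_div_factorial _).mul_left _
  have h := hasSum_integral_of_summable_integral_norm hint hsum
  have e1 (x : ℝ) : ∑' k, F k x = (clifford 0 x : ℂ) * Complex.exp (-(s * x)) := by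
    rw [clifford, Complex.ofReal_tsum, ← tsum_mul_right]
    congr with k
    simp only [hF, zero_add]
    push_cast
    rw [neg_pow]
    ring
  have e2 (k : ℕ) : ∫ x in Set.Ioi (0 : ℝ), F k x = 1 / s * ((-(1 / s)) ^ k / k.factorial) := by
    simp only [hF]
    rw [integral_const_mul, integral_pow_mul_cexp k hs, neg_pow (1 / s), one_div_pow, pow_succ]
    have : (k.factorial : ℂ) ≠ 0 := by exact_mod_cast k.factorial_ne_zero
    field_simp
    ring
  simp_rw [e1, e2] at h
  refine h.unique (HasSum.mul_left _ ?_)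
  rw [Complex.exp_eq_exp_ℂ]
  exact NormedSpace.expSeries_div_hasSum_exp (-(1 / s))

/-- The Laplace transform formula persists on the imaginary axis as a conditionally convergent
integral: after two integrations by parts the integral converges absolutely, hence is continuous
up to the boundary of the right half plane. -/
lemma tendsto_fourier_clifford {s : ℂ} (hs : s ≠ 0) (hre : s.re = 0) :
    Tendsto (fun Y : ℝ => ∫ x in (0 : ℝ)..Y, (clifford 0 x : ℂ) * Complex.exp (-(s * x))) atTop
      (𝓝 (1 / s * Complex.exp (-(1 / s)))) := by
  set L : ℂ → ℂ := fun s =>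
    1 / s ^ 2 * (∫ x in Set.Ioi (0 : ℝ), (clifford 2 x : ℂ) * Complex.exp (-(s * x))) +
        (1 / s - 1 / s ^ 2) with hL
  have h0 : Tendsto (fun Y : ℝ => ∫ x in (0 : ℝ)..Y, (clifford 0 x : ℂ) * Complex.exp (-(s * x)))
    atTop (𝓝 (L s)) := tendsto_integral_clifford_mul_exp hs hre.ge
  suffices L s = 1 / s * Complex.exp (-(1 / s)) by rwa [this] at h0
  have hpos {ε : ℝ} (hε : 0 < ε) : 0 < (s + ε).re := by simpa [hre] using hε
  have hne {ε : ℝ} (hε : 0 < ε) : s + ε ≠ 0 := fun h => by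
    have := hpos hε
    rw [h] at this
    exact lt_irrefl _ this
  have hε {ε : ℝ} (hε : 0 < ε) : L (s + ε) = 1 / (s + ε) * Complex.exp (-(1 / (s + ε))) := by
    obtain ⟨hi, he⟩ := laplace_clifford (hpos hε)
    rw [← he]
    exact tendsto_nhds_unique (tendsto_integral_clifford_mul_exp (hne hε) (hpos hε).le)
      (intervalIntegral_tendsto_integral_Ioi 0 hi tendsto_id)
  have hs' : Tendsto (fun ε : ℝ => s + ε) (𝓝[>] 0) (𝓝 s) := by
    have : Continuous fun ε : ℝ => s + ε := by fun_prop
    simpa using (this.tendsto 0).mono_left nhdsWithin_le_nhds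
  have hi' : Tendsto (fun ε : ℝ => 1 / (s + ε)) (𝓝[>] 0) (𝓝 (1 / s)) := by
    simpa using hs'.inv₀ hs
  have hi2 : Tendsto (fun ε : ℝ => 1 / (s + ε) ^ 2) (𝓝[>] 0) (𝓝 (1 / s ^ 2)) := by
    simpa using hi'.pow 2
  have hdom : Tendsto (fun ε : ℝ => ∫ x in Set.Ioi (0 : ℝ),
      (clifford 2 x : ℂ) * Complex.exp (-((s + ε) * x))) (𝓝[>] 0)
      (𝓝 (∫ x in Set.Ioi (0 : ℝ), (clifford 2 x : ℂ) * Complex.exp (-(s * x)))) := by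
    refine tendsto_integral_filter_of_dominated_convergence (fun x => ‖clifford 2 x‖) ?_ ?_
      integrableOn_clifford_two.norm (Eventually.of_forall fun x => ?_)
    · filter_upwards [self_mem_nhdsWithin] with ε hε
      exact (integrableOn_clifford_two_mul_exp (hpos hε).le).aestronglyMeasurable
    · filter_upwards [self_mem_nhdsWithin] with ε hε
      filter_upwards [ae_restrict_mem measurableSet_Ioi] with x hx
      rw [norm_mul, Complex.norm_real]
      exact mul_le_of_le_one_right (norm_nonneg _)
        (norm_exp_neg_mul_le_one (hpos hε).le (le_of_lt hx))
    · exact (((hs'.mul_const (x : ℂ)).neg).cexp).const_mul _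
  have h1 : Tendsto (fun ε : ℝ => L (s + ε)) (𝓝[>] 0) (𝓝 (L s)) :=
    (hi2.mul hdom).add (hi'.sub hi2)
  have h2 : Tendsto (fun ε : ℝ => L (s + ε)) (𝓝[>] 0) (𝓝 (1 / s * Complex.exp (-(1 / s)))) := by
    refine (hi'.mul hi'.neg.cexp).congr' ?_
    filter_upwards [self_mem_nhdsWithin] with ε h
    exact (hε h).symm
  exact tendsto_nhds_unique h1 h2

/-! ### Integrating the kernel against the question mark measure -/

lemma norm_exp_I_mul (x t : ℝ) : ‖Complex.exp (Complex.I * x * t)‖ = 1 := by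
  rw [show Complex.I * x * t = ((x * t : ℝ) : ℂ) * Complex.I by push_cast; ring,
    Complex.norm_exp_ofReal_mul_I]

lemma continuous_f : Continuous f := by
  refine continuous_of_dominated (μ := unitMeasure) (bound := fun _ => 1) (fun x => ?_)
    (fun x => Eventually.of_forall fun t => (norm_exp_I_mul x t).le) (integrable_const _)
    (Eventually.of_forall fun t => by fun_prop)
  exact Continuous.aestronglyMeasurable (by fun_prop)

lemma f_eq (x : ℝ) : f x = fc x + Complex.I * fs x := by
  have e (t : ℝ) : Complex.exp (Complex.I * x * t) =
      (Real.cos (x * t) : ℂ) + Complex.I * (Real.sin (x * t) : ℂ) := by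
    rw [show Complex.I * x * t = ((x * t : ℝ) : ℂ) * Complex.I by push_cast; ring,
      Complex.exp_mul_I, Complex.ofReal_cos, Complex.ofReal_sin, mul_comm Complex.I]
  change ∫ t : ℝ, Complex.exp (Complex.I * x * t) ∂unitMeasure =
    ((∫ t, Real.cos (x * t) ∂unitMeasure : ℝ) : ℂ) +
      Complex.I * ((∫ t, Real.sin (x * t) ∂unitMeasure : ℝ) : ℂ)
  rw [← integral_complex_ofReal, ← integral_complex_ofReal, ← integral_const_mul, ← integral_add]
  · exact integral_congr_ae (Eventually.of_forall e)
  · exact integrable_of_continuous (by fun_prop)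
  · exact integrable_of_continuous (by fun_prop)

lemma continuous_fc : Continuous fc := by
  have h : fc = fun x => (f x).re := by
    ext x
    simp [f_eq]
  rw [h]
  exact Complex.continuous_re.comp continuous_f

lemma continuous_fs : Continuous fs := by
  have h : fs = fun x => (f x).im := by
    ext x
    simp [f_eq]
  rw [h]
  exact Complex.continuous_im.comp continuous_f

/-- Exchange of the improper integral with the integration against `dq`: for each `t > 0` the inner
integral converges to the Fourier transform of the Bessel kernel, and it is dominated by a
combination of `1 / t` and `1 / t ^ 2`, which are integrable. -/
lemma tendsto_integral_clifford_mul_f {a : ℝ} (ha : 0 < a) :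
    Tendsto (fun Y : ℝ => ∫ y in (0 : ℝ)..Y, (clifford 0 (a * y) : ℂ) * f y) atTop
      (𝓝 (Complex.I *
        ∫ t : ℝ, (t : ℂ)⁻¹ * Complex.exp (-(Complex.I * a * (t : ℂ)⁻¹)) ∂unitMeasure)) := by
  have haC : (a : ℂ) ≠ 0 := by exact_mod_cast ha.ne'
  have hcl : Continuous fun y : ℝ => (clifford 0 y : ℂ) :=
    Complex.continuous_ofReal.comp (continuous_clifford 0)
  have hcont : Continuous fun p : ℝ × ℝ =>
      (clifford 0 (a * p.1) : ℂ) * Complex.exp (Complex.I * p.1 * p.2) :=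
    (hcl.comp (by fun_prop : Continuous fun p : ℝ × ℝ => a * p.1)).mul (by fun_prop)
  have hswap (Y : ℝ) : ∫ y in (0 : ℝ)..Y, (clifford 0 (a * y) : ℂ) * f y =
      ∫ t : ℝ, (∫ y in (0 : ℝ)..Y,
        (clifford 0 (a * y) : ℂ) * Complex.exp (Complex.I * y * t)) ∂unitMeasure := by
    rw [← intervalIntegral_integral_swap]
    · simp_rw [integral_const_mul]
      rfl
    · obtain ⟨C, hC⟩ := isCompact_uIcc.exists_bound_of_continuousOn (s := Set.uIcc 0 Y)
        (f := fun y => clifford 0 (a * y))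
        ((continuous_clifford 0).comp (continuous_const_mul a)).continuousOn
      have : IsFiniteMeasure (volume.restrict (Set.uIoc 0 Y)) := by
        unfold Set.uIoc
        infer_instance
      refine Integrable.of_bound hcont.aestronglyMeasurable C ?_
      have h1 : ∀ᵐ y ∂(volume.restrict (Set.uIoc 0 Y)), y ∈ Set.uIoc 0 Y :=
        ae_restrict_mem measurableSet_uIoc
      filter_upwards [Measure.quasiMeasurePreserving_fst.ae h1] with p hp
      change ‖(clifford 0 (a * p.1) : ℂ) * Complex.exp (Complex.I * p.1 * p.2)‖ ≤ C
      rw [norm_mul, norm_exp_I_mul, mul_one, Complex.norm_real]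
      exact hC _ (Set.uIoc_subset_uIcc hp)
  -- The substitution `x = a y` leads to the Laplace transform at `s = -I t / a`.
  have hscale (Y t : ℝ) : ∫ y in (0 : ℝ)..Y,
      (clifford 0 (a * y) : ℂ) * Complex.exp (Complex.I * y * t) =
      (a : ℂ)⁻¹ * ∫ x in (0 : ℝ)..a * Y, (clifford 0 x : ℂ) *
        Complex.exp (-(-(Complex.I * t / a) * x)) := by
    have h := intervalIntegral.integral_comp_mul_left (a := 0) (b := Y)
      (fun x : ℝ => (clifford 0 x : ℂ) * Complex.exp (-(-(Complex.I * t / a) * x))) ha.ne'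
    rw [mul_zero, Complex.real_smul, Complex.ofReal_inv] at h
    rw [← h]
    congr with y
    congr 2
    push_cast
    field_simp
  obtain ⟨K, hK⟩ := exists_norm_integral_clifford_mul_exp_le
  have hs0 {t : ℝ} (ht : 0 < t) : -(Complex.I * t / a) ≠ 0 := by
    have : (t : ℂ) ≠ 0 := by exact_mod_cast ht.ne'
    exact neg_ne_zero.mpr (div_ne_zero (mul_ne_zero Complex.I_ne_zero this) haC)
  have hsre (t : ℝ) : (-(Complex.I * t / a)).re = 0 := by
    rw [Complex.neg_re, Complex.div_ofReal_re]
    simp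
  have hsnorm {t : ℝ} (ht : 0 < t) : ‖-(Complex.I * t / a)‖⁻¹ = a * t⁻¹ := by
    rw [norm_neg, norm_div, norm_mul, Complex.norm_I, one_mul, Complex.norm_of_nonneg ht.le,
      Complex.norm_of_nonneg ha.le, inv_div, div_eq_mul_inv]
  simp_rw [hswap]
  rw [← integral_const_mul]
  refine tendsto_integral_filter_of_dominated_convergence
    (fun t => a⁻¹ * (K * (a * t⁻¹ + a ^ 2 * (t⁻¹) ^ 2))) ?_ ?_ ?_ ?_
  · refine Eventually.of_forall fun Y => Continuous.aestronglyMeasurable ?_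
    refine intervalIntegral.continuous_parametric_intervalIntegral_of_continuous' ?_ 0 Y
    exact hcont.comp continuous_swap
  · filter_upwards [eventually_ge_atTop 0] with Y hY
    filter_upwards [ae_mem_Ioc] with t ht
    rw [hscale, norm_mul, norm_inv, Complex.norm_of_nonneg ha.le]
    refine mul_le_mul_of_nonneg_left ?_ (inv_nonneg.mpr ha.le)
    have h := hK _ (hs0 ht.1) (hsre t).ge (a * Y) (by positivity)
    rwa [hsnorm ht.1, mul_pow] at h
  · exact (((integrable_inv.const_mul a).add (integrable_inv_sq.const_mul (a ^ 2))).const_mul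
      K).const_mul a⁻¹
  · filter_upwards [ae_mem_Ioc] with t ht
    have ht0 : (t : ℂ) ≠ 0 := by exact_mod_cast ht.1.ne'
    have h := ((tendsto_fourier_clifford (hs0 ht.1) (hsre t)).comp
      (tendsto_id.const_mul_atTop ha)).const_mul (a : ℂ)⁻¹
    have e : 1 / -(Complex.I * t / a) = Complex.I * a * (t : ℂ)⁻¹ := by
      have := Complex.I_ne_zero
      field_simp
      rw [Complex.I_sq]
    rw [e] at h
    simp_rw [hscale]
    have e' : Complex.I * ((t : ℂ)⁻¹ * Complex.exp (-(Complex.I * a * (t : ℂ)⁻¹))) =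
        (a : ℂ)⁻¹ * (Complex.I * a * (t : ℂ)⁻¹ *
          Complex.exp (-(Complex.I * a * (t : ℂ)⁻¹))) := by
      field_simp
    rw [e']
    exact h

/-! ### The Fourier coefficients -/

section Coefficients

variable (n : ℕ)

lemma integral_sin_eq_zero : ∫ t, Real.sin (2 * Real.pi * n * t) ∂unitMeasure = 0 := by
  have h := integral_comp_one_sub (g := fun t : ℝ => Real.sin (2 * Real.pi * n * t)) (by fun_prop)
  have e (t : ℝ) : Real.sin (2 * Real.pi * n * (1 - t)) = -Real.sin (2 * Real.pi * n * t) := by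
    rw [show 2 * Real.pi * n * (1 - t) = n * (2 * Real.pi) - 2 * Real.pi * n * t by ring,
      Real.sin_nat_mul_two_pi_sub]
  simp_rw [e, integral_neg] at h
  linarith

lemma integral_mul_cos : ∫ t, t * Real.cos (2 * Real.pi * n * t) ∂unitMeasure =
    1 / 2 * fc (2 * Real.pi * n) := by
  have h := integral_comp_one_sub (g := fun t : ℝ => t * Real.cos (2 * Real.pi * n * t))
    (by fun_prop)
  have e (t : ℝ) : (1 - t) * Real.cos (2 * Real.pi * n * (1 - t)) =
      Real.cos (2 * Real.pi * n * t) - t * Real.cos (2 * Real.pi * n * t) := by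
    rw [show 2 * Real.pi * n * (1 - t) = n * (2 * Real.pi) - 2 * Real.pi * n * t by ring,
      Real.cos_nat_mul_two_pi_sub]
    ring
  simp_rw [e] at h
  rw [integral_sub (integrable_of_continuous (by fun_prop))
    (integrable_of_continuous (by fun_prop))] at h
  change fc (2 * Real.pi * n) - _ = _ at h
  linarith

lemma integral_two_add_mul_exp :
    Complex.I * ∫ x : ℝ, (2 + x : ℂ) *
      Complex.exp (-(Complex.I * (2 * Real.pi * n : ℝ) * x)) ∂unitMeasure =
    c n + Complex.I * (5 / 2 * fc (2 * Real.pi * n) : ℝ) := by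
  have hcos : ∫ t, (2 + t) * Real.cos (2 * Real.pi * n * t) ∂unitMeasure =
      5 / 2 * fc (2 * Real.pi * n) := by
    simp_rw [add_mul]
    rw [integral_add (integrable_of_continuous (by fun_prop))
      (integrable_of_continuous (by fun_prop)), integral_const_mul, integral_mul_cos]
    change 2 * fc (2 * Real.pi * n) + _ = _
    ring
  have hsin : ∫ t, (2 + t) * Real.sin (2 * Real.pi * n * t) ∂unitMeasure = c n := by
    simp_rw [add_mul]
    rw [integral_add (integrable_of_continuous (by fun_prop))
      (integrable_of_continuous (by fun_prop)), integral_const_mul, integral_sin_eq_zero,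
      mul_zero, zero_add]
    rfl
  rw [← hcos, ← hsin, ← integral_complex_ofReal, ← integral_complex_ofReal, ← integral_const_mul,
    ← integral_const_mul, ← integral_add (integrable_of_continuous (by fun_prop))
      (integrable_of_continuous (by fun_prop))]
  refine integral_congr_ae (Eventually.of_forall fun x => ?_)
  have e : -(Complex.I * (2 * Real.pi * n : ℝ) * x) =
      ((-(2 * Real.pi * n * x) : ℝ) : ℂ) * Complex.I := by push_cast; ring
  simp only [e]
  rw [Complex.exp_mul_I, ← Complex.ofReal_cos, ← Complex.ofReal_sin, Real.cos_neg, Real.sin_neg]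
  push_cast
  linear_combination (-(2 + (x : ℂ)) * Complex.sin (2 * Real.pi * n * x)) * Complex.I_sq

lemma d_eq : d n = fc (2 * Real.pi * n) := by
  have h : fs (2 * Real.pi * n) = 0 := integral_sin_eq_zero n
  rw [d, f_eq, h]
  simp

end Coefficients

lemma hasImproperIntegral_of_clifford {a : ℝ} (ha : 0 < a) {g : ℝ → ℝ} (hg : Continuous g) {I : ℝ}
    (h : Tendsto (fun Y : ℝ => ∫ y in (0 : ℝ)..Y, clifford 0 (a * y) * g y) atTop (𝓝 I)) :
    HasImproperIntegral (fun y => J0 (2 * √(a * y)) * g y) I := by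
  have e {Y : ℝ} (hY : 0 ≤ Y) : Set.EqOn (fun y => clifford 0 (a * y) * g y)
      (fun y => J0 (2 * √(a * y)) * g y) (Set.uIcc 0 Y) := fun y hy => by
    rw [Set.uIcc_of_le hY] at hy
    simp only
    rw [J0_two_mul_sqrt (mul_nonneg ha.le hy.1)]
  constructor
  · intro Y hY
    have hc : Continuous fun y => clifford 0 (a * y) * g y :=
      ((continuous_clifford 0).comp (continuous_const_mul a)).mul hg
    exact (hc.intervalIntegrable 0 Y).congr ((e hY).mono Set.uIoc_subset_uIcc)
  · refine h.congr' ?_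
    filter_upwards [eventually_ge_atTop 0] with Y hY
    exact intervalIntegral.integral_congr (e hY)

lemma tendsto_integral_clifford_mul_fc_fs {n : ℕ} (hn : 1 ≤ n) :
    Tendsto (fun Y : ℝ => ∫ y in (0 : ℝ)..Y, clifford 0 (2 * Real.pi * n * y) * fc y) atTop
      (𝓝 (c n)) ∧
    Tendsto (fun Y : ℝ => ∫ y in (0 : ℝ)..Y, clifford 0 (2 * Real.pi * n * y) * fs y) atTop
      (𝓝 (5 / 2 * fc (2 * Real.pi * n))) := by
  have hn0 : (0 : ℝ) < n := by exact_mod_cast hn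
  have ha : 0 < 2 * Real.pi * n := by positivity
  have hexp : Complex.exp (-(Complex.I * (2 * Real.pi * n : ℝ))) = 1 := by
    rw [show -(Complex.I * (2 * Real.pi * n : ℝ)) =
      ((-n : ℤ) : ℂ) * (2 * Real.pi * Complex.I) by push_cast; ring, Complex.exp_int_mul_two_pi_mul_I]
  have h := tendsto_integral_clifford_mul_f ha
  rw [integral_exp_inv_mul_inv hexp, integral_two_add_mul_exp] at h
  have hc {g : ℝ → ℝ} (hg : Continuous g) :
      Continuous fun y => clifford 0 (2 * Real.pi * n * y) * g y :=
    ((continuous_clifford 0).comp (continuous_const_mul _)).mul hg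
  have e (Y : ℝ) : ∫ y in (0 : ℝ)..Y, (clifford 0 (2 * Real.pi * n * y) : ℂ) * f y =
      ((∫ y in (0 : ℝ)..Y, clifford 0 (2 * Real.pi * n * y) * fc y : ℝ) : ℂ) +
      Complex.I * ((∫ y in (0 : ℝ)..Y, clifford 0 (2 * Real.pi * n * y) * fs y : ℝ) : ℂ) := by
    rw [← intervalIntegral.integral_ofReal, ← intervalIntegral.integral_ofReal,
      ← intervalIntegral.integral_const_mul, ← intervalIntegral.integral_add]
    · congr with y
      rw [f_eq]
      push_cast
      ring
    · exact (Complex.continuous_ofReal.comp (hc continuous_fc)).intervalIntegrable _ _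
    · exact (continuous_const.mul
        (Complex.continuous_ofReal.comp (hc continuous_fs))).intervalIntegrable _ _
  simp_rw [e] at h
  constructor
  · have h1 := (Complex.continuous_re.tendsto _).comp h
    simpa [Function.comp_def] using h1
  · have h1 := (Complex.continuous_im.tendsto _).comp h
    simpa [Function.comp_def] using h1

end QuestionMark

theorem corollary1 (n : ℕ) (hn : 1 ≤ n) :
    (∃ I : ℝ,
      QuestionMark.HasImproperIntegral
        (fun y : ℝ => QuestionMark.J0 (2 * Real.sqrt (2 * Real.pi * n * y)) * QuestionMark.fs y) I ∧
      QuestionMark.d n = ((2 / 5 * I : ℝ) : ℂ)) ∧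
    (∃ I : ℝ,
      QuestionMark.HasImproperIntegral
        (fun y : ℝ => QuestionMark.J0 (2 * Real.sqrt (2 * Real.pi * n * y)) * QuestionMark.fc y) I ∧
      QuestionMark.c n = I) := by
  have hn0 : (0 : ℝ) < n := by exact_mod_cast hn
  have ha : 0 < 2 * Real.pi * n := by positivity
  obtain ⟨hc, hs⟩ := QuestionMark.tendsto_integral_clifford_mul_fc_fs hn
  refine ⟨⟨_, QuestionMark.hasImproperIntegral_of_clifford ha QuestionMark.continuous_fs hs, ?_⟩,
    _, QuestionMark.hasImproperIntegral_of_clifford ha QuestionMark.continuous_fc hc, rfl⟩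
  rw [QuestionMark.d_eq]
  congr 1
  ring
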